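/- Let $S_k$ be the group of permutations of $\{1,\dots,k\}$, where $\sigma\in S_k$ is written in vector notation $[\sigma(1),\dots,\sigma(k)]$ and $\sigma\tau=\sigma\circ\tau$. For $2\le j\le k$ let the push-to-the-top transition $t_{\uparrow j}:S_k\to S_k$ be $$t_{\uparrow j}([a_1,\dots,a_k])=[a_j,a_1,\dots,a_{j-1},a_{j+1},\dots,a_k].$$ A $G^{\mathrm{aux}}_{\uparrow}(k,M)$ is a sequence $C=(c_1,\dots,c_M)$ of $M$ distinct permutations in $S_k$ such that every $c_{r+1}$ ($1\le r<M$), and also $c_1$ with $c_M$ as its predecessor, is obtained from its predecessor by some transition $t_{\uparrow j}$ with $2\le j\le k$, and such that for all $q\in\{1,\dots,k-1\}$ and all $\sigma\in C$ we have $(q,k)\circ\sigma\notin C$, where $(q,k)$ is the transposition of $q$ and $k$. **Theorem.** Let $k\ge 6$ be even. Then there exists a $G^{\mathrm{aux}}_{\uparrow}(k,M)$ with $c_1=\mathrm{id}$ and $c_2=t_{\uparrow k}(\mathrm{id})$, where $$M=\begin{cases}178,& k=6,\\ (k-3)\left(\frac{(k-1)!}{2}+2\right)+1,& k>6.\end{cases}$$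 In particular, for all even $k>6$, $$M>\frac{k-3}{k}\cdot\frac{k!}{2}.$$ -/

import Mathlib

open Equiv

/-- The "push-to-the-`i`th-index" transition on the `j`th index (meant for `i < j`), acting on
the vector notation `[σ 0, σ 1, …, σ (n-1)]` of a permutation `σ` of `Fin n`: the entry at
index `j` is moved to index `i`, and the entries at indices `i, …, j - 1` move one place to the
right. It is right multiplication by the cycle `(j, j-1, …, i)`. -/
def pushToIndex {n : ℕ} (i j : Fin n) (σ : Perm (Fin n)) : Perm (Fin n) :=
  σ * (Fin.cycleIcc i j)⁻¹

theorem pushToIndex_apply_target {n : ℕ} [NeZero n] {i j : Fin n} (hij : i ≤ j)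
    (σ : Perm (Fin n)) : pushToIndex i j σ i = σ j := by
  have h : (Fin.cycleIcc i j)⁻¹ i = j := by
    rw [Perm.inv_eq_iff_eq, Fin.cycleIcc_of_last hij]
  rw [pushToIndex, Perm.mul_apply, h]

theorem pushToIndex_apply_between {n : ℕ} [NeZero n] {i j p : Fin n} (hip : i ≤ p) (hpj : p < j)
    (σ : Perm (Fin n)) : pushToIndex i j σ (p + 1) = σ p := by
  have h : (Fin.cycleIcc i j)⁻¹ (p + 1) = p := by
    rw [Perm.inv_eq_iff_eq, Fin.cycleIcc_of_ge_of_lt hip hpj]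
  rw [pushToIndex, Perm.mul_apply, h]

theorem pushToIndex_apply_outside {n : ℕ} {i j p : Fin n} (hp : p < i ∨ j < p)
    (σ : Perm (Fin n)) : pushToIndex i j σ p = σ p := by
  have h : (Fin.cycleIcc i j)⁻¹ p = p := by
    rw [Perm.inv_eq_iff_eq]
    rcases hp with hp | hp
    · rw [Fin.cycleIcc_of_lt hp]
    · rw [Fin.cycleIcc_of_gt hp]
  rw [pushToIndex, Perm.mul_apply, h]

/-- The "push-to-the-top" transition on index `j`. -/
def pushToTop {n : ℕ} [NeZero n] (j : Fin n) : Perm (Fin n) → Perm (Fin n) :=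
  pushToIndex 0 j

/-- A `T`-Gray code of size `M` over `S`: a sequence of `M` distinct elements of `S`, each of
which is obtained from its predecessor by a transition in `T`. -/
structure IsGrayCode {S : Type*} (T : Set (S → S)) {M : ℕ} (c : Fin M → S) : Prop where
  injective : Function.Injective c
  step : ∀ (r : ℕ) (h : r + 1 < M), ∃ t ∈ T, c ⟨r + 1, h⟩ = t (c ⟨r, Nat.lt_of_succ_lt h⟩)

/-- A cyclic `T`-Gray code: moreover its first element is obtained from its last one by a
transition in `T`. -/
structure IsCyclicGrayCode {S : Type*} (T : Set (S → S)) {M : ℕ} (c : Fin M → S) : Prop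
    extends IsGrayCode T c where
  cyclic : ∃ (h : 0 < M), ∃ t ∈ T, c ⟨0, h⟩ = t (c ⟨M - 1, Nat.sub_one_lt_of_lt h⟩)

/-- A "push-to-the-`i`th-index" code of size `M` in the symmetric group on `n` letters. -/
def IsPushToIndexCode {n M : ℕ} (i : Fin n) (c : Fin M → Perm (Fin n)) : Prop :=
  IsCyclicGrayCode {t | ∃ j : Fin n, i < j ∧ t = pushToIndex i j} c

/-- A "push-to-the-top" code of size `M` in the symmetric group on `n` letters. -/
def IsPushToTopCode {n M : ℕ} [NeZero n] (c : Fin M → Perm (Fin n)) : Prop :=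
  IsPushToIndexCode 0 c

/-- An auxiliary "push-to-the-top" code of size `M` in the symmetric group on `k` letters: it
never contains both `σ` and `(q, k) ∘ σ`, where `q` is a letter other than the last letter `k`
(which is `⊤ : Fin k`). -/
structure IsAuxCode {k M : ℕ} [NeZero k] (c : Fin M → Perm (Fin k)) : Prop where
  pushToTop : IsPushToTopCode c
  aux : ∀ q : Fin k, q < ⊤ → ∀ σ ∈ Set.range c, swap q ⊤ * σ ∉ Set.range c

/-- The sequence `c` starts at `x`, and its first transition is `t`. -/
def StartsWith {S : Type*} {M : ℕ} (c : Fin M → S) (x : S) (t : S → S) : Prop :=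
  ∃ h : 1 < M, c ⟨0, Nat.zero_lt_of_lt h⟩ = x ∧ c ⟨1, h⟩ = t x

/-! Write k = n + 1, so n is odd, and for n ≥ 7 call permutations with the same last entry and the
same sign a class. The code is the identity, then one path in each of n classes, then one closing
permutation. The last entries of these n classes are distinct and none of them is the letter n, so
exchanging q with n either keeps the last entry and reverses the sign, which leaves the code, or
brings n to the last place. In the second case the result could only be the identity or the closing
permutation. These two lie on one cycle of shifts of the first n entries, so each class has only one
shift cycle to beware of, that of a transposition f; by signs, this matters only in every other
class.

Inside a class, let T = `shift n` and let Q rotate the entries at n-3, n-2, n-1. Both T and QT are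
transitions (`top_sub_three`), and Q³ = 1. A step u → uT can therefore be replaced by a detour u →
uQT, …, uQ → uQ²T, …, uQ² → uT through the whole shift cycles of uQ and uQ² (`exists_glued_path`).
Conjugation by T turns Q into the rotation of any three consecutive entries among the first n. So a
tree in the 3-uniform hypergraph whose vertices are shift cycles, and whose hyperedges are such
rotations, yields a path (`exists_path_of_grows`).

A shift cycle is represented by its member with a fixed letter at index n-1. Growth adds vertices in
pairs, so a tree has an odd number of vertices, while there are evenly many even arrangements of N ≥
4 letters. Removing any one of them leaves a tree (`isHypertree_tailCoset_erase`). The freedom to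
choose the removed vertex drives the induction, and in `exists_class_path` it also lets the cycle of
f be avoided.

All these class paths have even length, whereas the required size is odd. One class therefore gets a
short path of odd length 2n - 3 (`exists_special_path`), and another gives up two shift cycles; with
n - 1 long paths and the two extra permutations this gives exactly M. For k = 6 an explicit word is
checked by computation. -/

/-! ### Trees in 3-uniform hypergraphs -/

/-- A step of growth in a 3-uniform hypergraph: a hyperedge with exactly one vertex in `A` adds its
two other vertices. -/
def GrowStep {V : Type*} [DecidableEq V] (E : V → V → V → Prop) (A B : Finset V) : Prop :=
  ∃ a b c, E a b c ∧ a ∈ A ∧ b ∉ A ∧ c ∉ A ∧ b ≠ c ∧ B = insert b (insert c A)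

/-- `B` is obtained from `A` by successive growth steps. -/
def Grows {V : Type*} [DecidableEq V] (E : V → V → V → Prop) : Finset V → Finset V → Prop :=
  Relation.ReflTransGen (GrowStep E)

/-- A set which grows from each of its vertices: the vertex set of a subtree of a 3-uniform
hypergraph. -/
def IsHypertree {V : Type*} [DecidableEq V] (E : V → V → V → Prop) (S : Finset V) : Prop :=
  ∀ v ∈ S, Grows E {v} S

section Hypertree

variable {V : Type*} [DecidableEq V] {E : V → V → V → Prop}

/-- A growth step only asks that its two new vertices be new, so vertices disjoint from the final
set may be present from the start. -/
theorem Grows.union_right {A B D : Finset V} (h : Grows E A B) (hD : Disjoint B D) :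
    Grows E (A ∪ D) (B ∪ D) := by
  induction h with
  | refl => exact Relation.ReflTransGen.refl
  | @tail B C _ hs ih =>
    obtain ⟨a, b, c, hE, ha, hb, hc, hbc, rfl⟩ := hs
    have hbD : b ∉ D := Finset.disjoint_left.1 hD (by simp)
    have hcD : c ∉ D := Finset.disjoint_left.1 hD (by simp)
    have hBD : Disjoint B D := hD.mono_left (fun x hx => by simp [hx])
    refine (ih hBD).tail ⟨a, b, c, hE, by simp [ha], by simp [hb, hbD], by simp [hc, hcD], hbc, ?_⟩
    ext x; simp

theorem isHypertree_singleton (v : V) : IsHypertree E {v} := by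
  intro w hw
  rw [Finset.mem_singleton.1 hw]
  exact Relation.ReflTransGen.refl

/-- The first tree is grown from `v`, the hyperedge then reaches one vertex of each other tree, and
these grow from that vertex. This is why trees are required to grow from every vertex. -/
theorem IsHypertree.grows_join {S₁ S₂ S₃ : Finset V} (h₁ : IsHypertree E S₁)
    (h₂ : IsHypertree E S₂) (h₃ : IsHypertree E S₃) (h₁₂ : Disjoint S₁ S₂) (h₁₃ : Disjoint S₁ S₃)
    (h₂₃ : Disjoint S₂ S₃) {v₁ v₂ v₃ : V} (m₁ : v₁ ∈ S₁) (m₂ : v₂ ∈ S₂) (m₃ : v₃ ∈ S₃)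
    (hE : E v₁ v₂ v₃) {v : V} (hv : v ∈ S₁) : Grows E {v} (S₁ ∪ S₂ ∪ S₃) := by
  have n₂ : v₂ ∉ S₁ := fun h => Finset.disjoint_left.1 h₁₂ h m₂
  have n₃ : v₃ ∉ S₁ := fun h => Finset.disjoint_left.1 h₁₃ h m₃
  have n₂₃ : v₂ ≠ v₃ := fun h => Finset.disjoint_left.1 h₂₃ m₂ (h ▸ m₃)
  have s₁ : Grows E {v} (insert v₂ (insert v₃ S₁)) :=
    (h₁ v hv).tail ⟨v₁, v₂, v₃, hE, m₁, n₂, n₃, n₂₃, rfl⟩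
  have s₂ := (h₂ v₂ m₂).union_right (D := insert v₃ S₁) (by
    rw [Finset.disjoint_insert_right]
    exact ⟨fun h => Finset.disjoint_left.1 h₂₃ h m₃, h₁₂.symm⟩)
  have s₃ := (h₃ v₃ m₃).union_right (D := S₂ ∪ S₁) (by
    rw [Finset.disjoint_union_right]; exact ⟨h₂₃.symm, h₁₃.symm⟩)
  have e₁ : ({v₂} : Finset V) ∪ insert v₃ S₁ = insert v₂ (insert v₃ S₁) := by
    ext x; simp only [Finset.mem_union, Finset.mem_singleton, Finset.mem_insert]
  have e₂ : ({v₃} : Finset V) ∪ (S₂ ∪ S₁) = S₂ ∪ insert v₃ S₁ := by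
    ext x; simp only [Finset.mem_union, Finset.mem_singleton, Finset.mem_insert]; tauto
  have e₃ : S₃ ∪ (S₂ ∪ S₁) = S₁ ∪ S₂ ∪ S₃ := by
    ext x; simp only [Finset.mem_union]; tauto
  rw [e₁] at s₂; rw [e₂, e₃] at s₃
  exact (s₁.trans s₂).trans s₃

theorem IsHypertree.join (hcyc : ∀ a b c, E a b c → E b c a) {S₁ S₂ S₃ : Finset V}
    (h₁ : IsHypertree E S₁) (h₂ : IsHypertree E S₂) (h₃ : IsHypertree E S₃)
    (h₁₂ : Disjoint S₁ S₂) (h₁₃ : Disjoint S₁ S₃) (h₂₃ : Disjoint S₂ S₃) {v₁ v₂ v₃ : V}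
    (m₁ : v₁ ∈ S₁) (m₂ : v₂ ∈ S₂) (m₃ : v₃ ∈ S₃) (hE : E v₁ v₂ v₃) :
    IsHypertree E (S₁ ∪ S₂ ∪ S₃) := by
  intro v hv
  have e₁ : S₂ ∪ S₃ ∪ S₁ = S₁ ∪ S₂ ∪ S₃ := by ext x; simp only [Finset.mem_union]; tauto
  have e₂ : S₃ ∪ S₁ ∪ S₂ = S₁ ∪ S₂ ∪ S₃ := by ext x; simp only [Finset.mem_union]; tauto
  simp only [Finset.mem_union] at hv
  rcases hv with (hv | hv) | hv
  · exact h₁.grows_join h₂ h₃ h₁₂ h₁₃ h₂₃ m₁ m₂ m₃ hE hv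
  · rw [← e₁]
    exact h₂.grows_join h₃ h₁ h₂₃ h₁₂.symm h₁₃.symm m₂ m₃ m₁ (hcyc _ _ _ hE) hv
  · rw [← e₂]
    exact h₃.grows_join h₁ h₂ h₁₃.symm h₂₃.symm h₁₂ m₃ m₁ m₂ (hcyc _ _ _ (hcyc _ _ _ hE)) hv

/-- A tree with more than one vertex is completed by a last growth step. -/
theorem Grows.exists_last {v : V} {S : Finset V} (h : Grows E {v} S) (hS : 1 < S.card) :
    ∃ S', Grows E {v} S' ∧ S' ⊆ S ∧ S'.card + 2 = S.card := by
  rcases Relation.ReflTransGen.cases_tail h with h' | ⟨S', h', a, b, c, -, -, hb, hc, hbc, rfl⟩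
  · simp [h'] at hS
  · refine ⟨S', h', fun x hx => by simp [hx], ?_⟩
    rw [Finset.card_insert_of_notMem (by simp [hb, hbc]), Finset.card_insert_of_notMem hc]

end Hypertree

/-! ### Positions and rotations of three consecutive entries -/

theorem perm_apply_inv {α : Type*} (g : Perm α) (z : α) : g (g⁻¹ z) = z := g.apply_symm_apply z

theorem perm_inv_apply {α : Type*} (g : Perm α) (z : α) : g⁻¹ (g z) = z := g.symm_apply_apply z

/-- The position with index `j`. -/
def pos (n j : ℕ) : Fin (n + 1) := Fin.ofNat (n + 1) j

theorem pos_val {n j : ℕ} (h : j ≤ n) : (pos n j).val = j :=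
  Nat.mod_eq_of_lt (Nat.lt_succ_of_le h)

theorem pos_val_self {n : ℕ} (p : Fin (n + 1)) : pos n p.val = p :=
  Fin.ext (pos_val (Nat.le_of_lt_succ p.isLt))

theorem pos_ne {n i j : ℕ} (hi : i ≤ n) (hj : j ≤ n) (h : i ≠ j) : pos n i ≠ pos n j := fun e =>
  h (by rw [← pos_val hi, ← pos_val hj, e])

theorem ne_pos {n j : ℕ} {p : Fin (n + 1)} (hj : j ≤ n) (h : p.val ≠ j) : p ≠ pos n j := fun e =>
  h (by rw [e, pos_val hj])

/-- The 3-cycle of positions whose right action turns the entries `x, y, z` at the indices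
`j, j + 1, j + 2` into `y, z, x`. -/
def rot3 (n j : ℕ) : Perm (Fin (n + 1)) :=
  swap (pos n j) (pos n (j + 1)) * swap (pos n (j + 1)) (pos n (j + 2))

section rot3

variable {n j : ℕ}

theorem rot3_apply_zero (h : j + 2 ≤ n) : rot3 n j (pos n j) = pos n (j + 1) := by
  rw [rot3, Perm.mul_apply, swap_apply_of_ne_of_ne (a := pos n (j + 1)), swap_apply_left]
  all_goals exact pos_ne (by lia) (by lia) (by lia)

theorem rot3_apply_one (h : j + 2 ≤ n) : rot3 n j (pos n (j + 1)) = pos n (j + 2) := by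
  rw [rot3, Perm.mul_apply, swap_apply_left, swap_apply_of_ne_of_ne]
  all_goals exact pos_ne (by lia) (by lia) (by lia)

theorem rot3_apply_two : rot3 n j (pos n (j + 2)) = pos n j := by
  rw [rot3, Perm.mul_apply, swap_apply_right, swap_apply_right]

theorem rot3_apply_of_ne (h : j + 2 ≤ n) {p : Fin (n + 1)} (h₀ : p.val ≠ j)
    (h₁ : p.val ≠ j + 1) (h₂ : p.val ≠ j + 2) : rot3 n j p = p := by
  rw [rot3, Perm.mul_apply, swap_apply_of_ne_of_ne (a := pos n (j + 1)),
    swap_apply_of_ne_of_ne]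
  all_goals exact ne_pos (by lia) (by lia)

theorem rot3_apply_pos_of_ne (h : j + 2 ≤ n) {i : ℕ} (hi : i ≤ n) (h₀ : i ≠ j)
    (h₁ : i ≠ j + 1) (h₂ : i ≠ j + 2) : rot3 n j (pos n i) = pos n i :=
  rot3_apply_of_ne h (by rwa [pos_val hi]) (by rwa [pos_val hi]) (by rwa [pos_val hi])

theorem sign_rot3 (h : j + 2 ≤ n) : Perm.sign (rot3 n j) = 1 := by
  rw [rot3, Perm.sign_mul, Perm.sign_swap (pos_ne (by lia) (by lia) (by lia)),
    Perm.sign_swap (pos_ne (by lia) (by lia) (by lia))]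
  rfl

theorem rot3_mul_rot3_mul_rot3 (h : j + 2 ≤ n) : rot3 n j * rot3 n j * rot3 n j = 1 := by
  ext p : 1
  simp only [Perm.mul_apply, Perm.one_apply]
  by_cases h₀ : p = pos n j
  · rw [h₀, rot3_apply_zero h, rot3_apply_one h, rot3_apply_two]
  by_cases h₁ : p = pos n (j + 1)
  · rw [h₁, rot3_apply_one h, rot3_apply_two, rot3_apply_zero h]
  by_cases h₂ : p = pos n (j + 2)
  · rw [h₂, rot3_apply_two, rot3_apply_zero h, rot3_apply_one h]
  have h₃ : rot3 n j p = p := rot3_apply_of_ne h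
    (fun e => h₀ (by rw [← e, pos_val_self])) (fun e => h₁ (by rw [← e, pos_val_self]))
    (fun e => h₂ (by rw [← e, pos_val_self]))
  rw [h₃, h₃, h₃]

end rot3

/-- The hyperedges `{a, aQ, aQ²}`, where `Q` rotates three consecutive entries among the first
`n`. -/
def RotEdge (n : ℕ) (a b c : Perm (Fin (n + 1))) : Prop :=
  ∃ j, j + 2 < n ∧ b = a * rot3 n j ∧ c = a * rot3 n j * rot3 n j

theorem RotEdge.cyclic {n : ℕ} (a b c : Perm (Fin (n + 1))) (h : RotEdge n a b c) :
    RotEdge n b c a := by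
  obtain ⟨j, hj, rfl, rfl⟩ := h
  refine ⟨j, hj, rfl, ?_⟩
  have := rot3_mul_rot3_mul_rot3 (n := n) (j := j) hj.le
  simp only [mul_assoc] at this ⊢
  rw [this, mul_one]

/-! ### Even arrangements of the first entries -/

/-- The permutations of the same sign as `g` which agree with `g` from index `N` on. -/
def tailCoset (n N : ℕ) (g : Perm (Fin (n + 1))) : Finset (Perm (Fin (n + 1))) :=
  Finset.univ.filter fun σ => (∀ p, N ≤ p.val → σ p = g p) ∧ Perm.sign σ = Perm.sign g

section tailCoset

variable {n N : ℕ} {g h : Perm (Fin (n + 1))}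

theorem mem_tailCoset {σ : Perm (Fin (n + 1))} : σ ∈ tailCoset n N g ↔
    (∀ p, N ≤ p.val → σ p = g p) ∧ Perm.sign σ = Perm.sign g := by
  simp [tailCoset]

theorem self_mem_tailCoset : g ∈ tailCoset n N g := mem_tailCoset.2 ⟨fun _ _ => rfl, rfl⟩

theorem mul_mem_tailCoset (hh : h ∈ tailCoset n N g) {τ : Perm (Fin (n + 1))}
    (hτ : ∀ p : Fin (n + 1), N ≤ p.val → τ p = p) (hs : Perm.sign τ = 1) :
    h * τ ∈ tailCoset n N g := by
  obtain ⟨h₁, h₂⟩ := mem_tailCoset.1 hh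
  refine mem_tailCoset.2 ⟨fun p hp => ?_, by rw [Perm.sign_mul, hs, h₂, mul_one]⟩
  rw [Perm.mul_apply, hτ p hp, h₁ p hp]

theorem mul_rot3_mem_tailCoset (hh : h ∈ tailCoset n N g) {j : ℕ} (hj : j + 2 < N)
    (hN : N ≤ n + 1) : h * rot3 n j ∈ tailCoset n N g :=
  mul_mem_tailCoset hh
    (fun _ hp => rot3_apply_of_ne (by lia) (by lia) (by lia) (by lia)) (sign_rot3 (by lia))

/-- The part of a coset with a given entry at its last free index. -/
theorem tailCoset_succ_filter (hN : N ≤ n) (hh : h ∈ tailCoset n (N + 1) g) :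
    ((tailCoset n (N + 1) g).filter fun σ => σ (pos n N) = h (pos n N)) = tailCoset n N h := by
  obtain ⟨h₁, h₂⟩ := mem_tailCoset.1 hh
  ext σ
  simp only [Finset.mem_filter, mem_tailCoset, h₂]
  constructor
  · rintro ⟨⟨H₁, H₂⟩, H₃⟩
    refine ⟨fun p hp => ?_, H₂⟩
    rcases hp.eq_or_lt with hp | hp
    · rwa [hp, pos_val_self] at H₃
    · rw [H₁ p hp, h₁ p hp]
  · rintro ⟨H₁, H₂⟩
    exact ⟨⟨fun p hp => (H₁ p (by lia)).trans (h₁ p hp), H₂⟩, H₁ _ (pos_val hN).ge⟩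

/-- The entries of `g` at the indices up to `N`. -/
def headLetters (n N : ℕ) (g : Perm (Fin (n + 1))) : Finset (Fin (n + 1)) :=
  Finset.univ.filter fun z => (g⁻¹ z).val ≤ N

theorem mem_headLetters {z : Fin (n + 1)} : z ∈ headLetters n N g ↔ (g⁻¹ z).val ≤ N := by
  simp [headLetters]

theorem card_headLetters (hN : N ≤ n) : (headLetters n N g).card = N + 1 := by
  have : headLetters n N g = (Finset.Iic (pos n N)).map g.toEmbedding := by
    ext z
    simp only [mem_headLetters, Finset.mem_map_equiv, Finset.mem_Iic, Fin.le_def, pos_val hN]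
    rfl
  rw [this, Finset.card_map, Fin.card_Iic, pos_val hN]

theorem apply_mem_headLetters (hh : h ∈ tailCoset n (N + 1) g) {p : Fin (n + 1)} :
    h p ∈ headLetters n N g ↔ p.val ≤ N := by
  obtain ⟨h₁, -⟩ := mem_tailCoset.1 hh
  rw [mem_headLetters]
  constructor
  · intro H
    by_contra! hp
    rw [h₁ p hp, perm_inv_apply] at H
    lia
  · intro H
    by_contra! hp
    have h₂ := h₁ _ hp
    rw [perm_apply_inv] at h₂
    rw [h.injective h₂] at hp
    lia

/-- One exchange of positions brings `y` to `q`. The last clause allows entries prescribed earlier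
to survive later uses. -/
theorem exists_agree_apply_eq {σ : Perm (Fin (n + 1))} {q : ℕ} {y : Fin (n + 1)} (hN : N ≤ n)
    (hq : q ≤ N) (hσ : ∀ p : Fin (n + 1), N < p.val → σ p = g p) (hy : y ∈ headLetters n N g) :
    ∃ σ' : Perm (Fin (n + 1)), (∀ p : Fin (n + 1), N < p.val → σ' p = g p) ∧
      σ' (pos n q) = y ∧ ∀ r, r ≠ pos n q → σ r ≠ y → σ' r = σ r := by
  have hy' : (σ⁻¹ y).val ≤ N := by
    by_contra! H
    have h₁ := hσ _ H
    rw [perm_apply_inv] at h₁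
    rw [mem_headLetters, h₁, perm_inv_apply] at hy
    lia
  refine ⟨σ * swap (σ⁻¹ y) (pos n q), fun p hp => ?_, ?_, fun r hr hry => ?_⟩
  · rw [Perm.mul_apply, swap_apply_of_ne_of_ne (fun e => by rw [e] at hp; lia)
      (ne_pos (by lia) (by lia)), hσ p hp]
  · rw [Perm.mul_apply, swap_apply_right, perm_apply_inv]
  · rw [Perm.mul_apply, swap_apply_of_ne_of_ne (fun e => hry (by rw [e, perm_apply_inv])) hr]

/-- The sign can be adjusted without changing the entries from index `2` on. -/
theorem exists_mem_tailCoset_agree {σ : Perm (Fin (n + 1))} (h2 : 2 ≤ N) (hN : N ≤ n + 1)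
    (hσ : ∀ p : Fin (n + 1), N ≤ p.val → σ p = g p) :
    ∃ e ∈ tailCoset n N g, ∀ p : Fin (n + 1), 2 ≤ p.val → e p = σ p := by
  by_cases hs : Perm.sign σ = Perm.sign g
  · exact ⟨σ, mem_tailCoset.2 ⟨hσ, hs⟩, fun _ _ => rfl⟩
  · have fix : ∀ p : Fin (n + 1), 2 ≤ p.val → (σ * swap (pos n 0) (pos n 1)) p = σ p :=
      fun p hp => by
        rw [Perm.mul_apply, swap_apply_of_ne_of_ne (ne_pos (by lia) (by lia))
          (ne_pos (by lia) (by lia))]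
    refine ⟨_, mem_tailCoset.2 ⟨fun p hp => (fix p (h2.trans hp)).trans (hσ p hp), ?_⟩, fix⟩
    rw [Perm.sign_mul, Perm.sign_swap (pos_ne (by lia) (by lia) (by lia)), mul_neg, mul_one]
    rcases Int.units_eq_one_or (Perm.sign σ) with h₁ | h₁ <;>
      rcases Int.units_eq_one_or (Perm.sign g) with h₂ | h₂ <;> simp_all

/-- One can prescribe the entries at the last three free indices. -/
theorem exists_mem_tailCoset (h2 : 4 ≤ N) (hN : N ≤ n) {a b z : Fin (n + 1)}
    (ha : a ∈ headLetters n N g) (hb : b ∈ headLetters n N g) (hz : z ∈ headLetters n N g)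
    (hab : a ≠ b) (haz : a ≠ z) (hbz : b ≠ z) :
    ∃ e ∈ tailCoset n (N + 1) g,
      e (pos n (N - 2)) = a ∧ e (pos n (N - 1)) = b ∧ e (pos n N) = z := by
  obtain ⟨σ₁, t₁, u₁, -⟩ := exists_agree_apply_eq hN le_rfl (fun _ _ => rfl) hz
  obtain ⟨σ₂, t₂, u₂, w₂⟩ := exists_agree_apply_eq (q := N - 1) hN (by lia) t₁ hb
  obtain ⟨σ₃, t₃, u₃, w₃⟩ := exists_agree_apply_eq (q := N - 2) hN (by lia) t₂ ha
  have z₂ : σ₂ (pos n N) = z := by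
    rw [w₂ _ (pos_ne hN (by lia) (by lia)) (by rw [u₁]; exact hbz.symm), u₁]
  have z₃ : σ₃ (pos n N) = z := by
    rw [w₃ _ (pos_ne hN (by lia) (by lia)) (by rw [z₂]; exact haz.symm), z₂]
  have b₃ : σ₃ (pos n (N - 1)) = b := by
    rw [w₃ _ (pos_ne (by lia) (by lia) (by lia)) (by rw [u₂]; exact hab.symm), u₂]
  obtain ⟨e, he, hf⟩ := exists_mem_tailCoset_agree (N := N + 1) (by lia) (by lia) t₃
  refine ⟨e, he, ?_, ?_, ?_⟩
  · rw [hf _ (by rw [pos_val (by lia)]; lia), u₃]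
  · rw [hf _ (by rw [pos_val (by lia)]; lia), b₃]
  · rw [hf _ (by rw [pos_val (by lia)]; lia), z₃]

/-- The induction sorts a coset by its last free entry. It starts at two free indices, where the
sign leaves a single arrangement. -/
theorem two_mul_card_tailCoset (h2 : 2 ≤ N) (hN : N ≤ n + 1) (g : Perm (Fin (n + 1))) :
    2 * (tailCoset n N g).card = N.factorial := by
  induction N, h2 using Nat.le_induction generalizing g with
  | base =>
    have : tailCoset n 2 g = {g} := by
      ext σ
      simp only [mem_tailCoset, Finset.mem_singleton]
      refine ⟨fun ⟨h₁, h₂⟩ => ?_, fun e => by simp [e]⟩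
      have h₃ : ∀ p : Fin (n + 1), 2 ≤ p.val → (g⁻¹ * σ) p = p := fun p hp => by
        rw [Perm.mul_apply, h₁ p hp, perm_inv_apply]
      have n₁ : pos n 0 ≠ pos n 1 := pos_ne (by lia) (by lia) (by lia)
      have h₄ : ∀ p : Fin (n + 1), p.val < 2 → p = pos n 0 ∨ p = pos n 1 := fun p hp => by
        have : p.val = 0 ∨ p.val = 1 := by lia
        rcases this with h | h <;> rw [← pos_val_self p, h] <;> simp
      have h₅ : ∀ p : Fin (n + 1), p.val < 2 → ((g⁻¹ * σ) p).val < 2 := fun p hp => by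
        by_contra! H
        have := (g⁻¹ * σ).injective (h₃ _ H)
        rw [this] at H
        lia
      have hs : Perm.sign (g⁻¹ * σ) = 1 := by
        rw [Perm.sign_mul, Perm.sign_inv, h₂, Int.units_mul_self]
      have key : g⁻¹ * σ = 1 := by
        rcases h₄ _ (h₅ (pos n 0) (by rw [pos_val (by lia)]; lia)) with h₀ | h₀
        · ext p : 1
          rcases lt_or_ge p.val 2 with hp | hp
          · rcases h₄ p hp with rfl | rfl
            · rw [h₀, Perm.one_apply]
            · rcases h₄ _ (h₅ (pos n 1) hp) with h₆ | h₆
              · exact absurd ((g⁻¹ * σ).injective (h₆.trans h₀.symm)) n₁.symm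
              · rw [h₆, Perm.one_apply]
          · rw [h₃ p hp, Perm.one_apply]
        · have h₇ : g⁻¹ * σ = swap (pos n 0) (pos n 1) := by
            ext p : 1
            rcases lt_or_ge p.val 2 with hp | hp
            · rcases h₄ p hp with rfl | rfl
              · rw [h₀, swap_apply_left]
              · rcases h₄ _ (h₅ (pos n 1) hp) with h₆ | h₆
                · rw [h₆, swap_apply_right]
                · exact absurd ((g⁻¹ * σ).injective (h₆.trans h₀.symm)) n₁.symm
            · rw [h₃ p hp, swap_apply_of_ne_of_ne (ne_pos (by lia) (by lia))
                (ne_pos (by lia) (by lia))]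
          rw [h₇, Perm.sign_swap n₁] at hs
          exact absurd hs (by decide)
      rw [← mul_one g, ← key, mul_inv_cancel_left]
    simp [this]
  | succ N h2 ih =>
    have hfib : ∀ z ∈ headLetters n N g,
        2 * ((tailCoset n (N + 1) g).filter fun σ => σ (pos n N) = z).card = N.factorial := by
      intro z hz
      obtain ⟨σ, t, u, -⟩ := exists_agree_apply_eq (N := N) (by lia) le_rfl (fun _ _ => rfl) hz
      obtain ⟨e, he, hf⟩ := exists_mem_tailCoset_agree (N := N + 1) (by lia) (by lia) t
      rw [← u, ← hf _ (by rw [pos_val (by lia)]; lia), tailCoset_succ_filter (by lia) he]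
      exact ih (by lia) e
    rw [Finset.card_eq_sum_card_fiberwise (f := fun σ => σ (pos n N))
      (t := headLetters n N g) (fun σ hσ => (apply_mem_headLetters hσ).2 (pos_val (by lia)).le),
      Finset.mul_sum, Finset.sum_congr rfl hfib, Finset.sum_const, card_headLetters (by lia),
      smul_eq_mul, Nat.factorial_succ]

end tailCoset

/-! ### Trees of even arrangements -/

section RotTree

variable {n M : ℕ} {g : Perm (Fin (n + 1))}

theorem mul_rot3_apply (hM : M + 2 ≤ n) (σ : Perm (Fin (n + 1))) :
    (σ * rot3 n M) (pos n M) = σ (pos n (M + 1)) ∧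
    (σ * rot3 n M) (pos n (M + 1)) = σ (pos n (M + 2)) ∧
    (σ * rot3 n M) (pos n (M + 2)) = σ (pos n M) := by
  refine ⟨?_, ?_, ?_⟩
  · rw [Perm.mul_apply, rot3_apply_zero hM]
  · rw [Perm.mul_apply, rot3_apply_one hM]
  · rw [Perm.mul_apply, rot3_apply_two]

theorem mul_rot3_mul_rot3_apply (hM : M + 2 ≤ n) (σ : Perm (Fin (n + 1))) :
    (σ * rot3 n M * rot3 n M) (pos n M) = σ (pos n (M + 2)) ∧
    (σ * rot3 n M * rot3 n M) (pos n (M + 1)) = σ (pos n M) ∧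
    (σ * rot3 n M * rot3 n M) (pos n (M + 2)) = σ (pos n (M + 1)) := by
  obtain ⟨h₀, h₁, h₂⟩ := mul_rot3_apply hM σ
  obtain ⟨k₀, k₁, k₂⟩ := mul_rot3_apply hM (σ * rot3 n M)
  exact ⟨k₀.trans h₁, k₁.trans h₂, k₂.trans h₀⟩

/-- The part of a coset with entry `z` at the index `M + 2`. -/
def letterPart (n M : ℕ) (g : Perm (Fin (n + 1))) (z : Fin (n + 1)) :
    Finset (Perm (Fin (n + 1))) :=
  (tailCoset n (M + 3) g).filter fun σ => σ (pos n (M + 2)) = z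

theorem mem_letterPart {z : Fin (n + 1)} {σ : Perm (Fin (n + 1))} :
    σ ∈ letterPart n M g z ↔ σ ∈ tailCoset n (M + 3) g ∧ σ (pos n (M + 2)) = z := by
  simp [letterPart]

theorem letterPart_eq (hM : M + 2 ≤ n) {h : Perm (Fin (n + 1))}
    (hh : h ∈ tailCoset n (M + 3) g) :
    letterPart n M g (h (pos n (M + 2))) = tailCoset n (M + 2) h :=
  tailCoset_succ_filter hM hh

/-- With z the last free entry of `h`, take `e` ending in a, b, z and `f` ending in b, a, z, both in
the tree. Their rotation triples each meet the cosets of a and b once. These cosets become trees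
only after losing a vertex, so the two vertices reached from `f` are removed, the triple of `e`
joins the three trees, and the triple of `f` restores the removed pair. The last two hypotheses keep
`e` and `f` away from the missing vertex `h`. -/
theorem IsHypertree.add_pair (h2 : 2 ≤ M) (hM : M + 2 < n)
    (ih : ∀ g, IsHypertree (RotEdge n) ((tailCoset n (M + 2) g).erase g))
    {S : Finset (Perm (Fin (n + 1)))} (hS : IsHypertree (RotEdge n) S)
    {h : Perm (Fin (n + 1))} (hh : h ∈ tailCoset n (M + 3) g) {a b : Fin (n + 1)}
    (ha : a ∈ headLetters n (M + 2) g) (hb : b ∈ headLetters n (M + 2) g) (hab : a ≠ b)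
    (haz : a ≠ h (pos n (M + 2))) (hbz : b ≠ h (pos n (M + 2)))
    (hsub : (letterPart n M g (h (pos n (M + 2)))).erase h ⊆ S)
    (hdis : ∀ σ ∈ S, σ (pos n (M + 2)) ≠ a ∧ σ (pos n (M + 2)) ≠ b)
    (hne : ¬ (h (pos n M) = a ∧ h (pos n (M + 1)) = b))
    (hne' : ¬ (h (pos n M) = b ∧ h (pos n (M + 1)) = a)) :
    IsHypertree (RotEdge n) (S ∪ letterPart n M g a ∪ letterPart n M g b) := by
  have hz : h (pos n (M + 2)) ∈ headLetters n (M + 2) g :=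
    (apply_mem_headLetters hh).2 (pos_val hM.le).le
  obtain ⟨e, he, ea, eb, ez⟩ : ∃ e ∈ tailCoset n (M + 3) g, e (pos n M) = a ∧
      e (pos n (M + 1)) = b ∧ e (pos n (M + 2)) = h (pos n (M + 2)) :=
    exists_mem_tailCoset (by lia) hM.le ha hb hz hab haz hbz
  obtain ⟨f, hf, fb, fa, fz⟩ : ∃ e ∈ tailCoset n (M + 3) g, e (pos n M) = b ∧
      e (pos n (M + 1)) = a ∧ e (pos n (M + 2)) = h (pos n (M + 2)) :=
    exists_mem_tailCoset (by lia) hM.le hb ha hz hab.symm hbz haz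
  obtain ⟨e₀, e₁, e₂⟩ := mul_rot3_apply hM.le e
  obtain ⟨e₃, e₄, e₅⟩ := mul_rot3_mul_rot3_apply hM.le e
  obtain ⟨f₀, f₁, f₂⟩ := mul_rot3_apply hM.le f
  obtain ⟨f₃, f₄, f₅⟩ := mul_rot3_mul_rot3_apply hM.le f
  have me₁ := mul_rot3_mem_tailCoset he (j := M) (by lia) (by lia)
  have me₂ := mul_rot3_mem_tailCoset me₁ (j := M) (by lia) (by lia)
  have mf₁ := mul_rot3_mem_tailCoset hf (j := M) (by lia) (by lia)
  have mf₂ := mul_rot3_mem_tailCoset mf₁ (j := M) (by lia) (by lia)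
  set eq := e * rot3 n M with heq
  set fq := f * rot3 n M with hfq
  set er := eq * rot3 n M with her
  set fr := fq * rot3 n M with hfr
  rw [ea] at e₂; rw [eb] at e₅; rw [fb] at f₂; rw [fa] at f₅
  have heS : e ∈ S := hsub (Finset.mem_erase.2
    ⟨fun E => hne (E ▸ ⟨ea, eb⟩), mem_letterPart.2 ⟨he, ez⟩⟩)
  have hfS : f ∈ S := hsub (Finset.mem_erase.2
    ⟨fun E => hne' (E ▸ ⟨fb, fa⟩), mem_letterPart.2 ⟨hf, fz⟩⟩)
  have tA : IsHypertree (RotEdge n) ((letterPart n M g a).erase fr) := by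
    rw [← f₅, letterPart_eq hM.le mf₂]; exact ih fr
  have tB : IsHypertree (RotEdge n) ((letterPart n M g b).erase fq) := by
    rw [← f₂, letterPart_eq hM.le mf₁]; exact ih fq
  have dSA : Disjoint S (letterPart n M g a) := Finset.disjoint_left.2
    fun σ h₁ h₂ => (hdis σ h₁).1 (mem_letterPart.1 h₂).2
  have dSB : Disjoint S (letterPart n M g b) := Finset.disjoint_left.2
    fun σ h₁ h₂ => (hdis σ h₁).2 (mem_letterPart.1 h₂).2
  have dAB : Disjoint (letterPart n M g a) (letterPart n M g b) := Finset.disjoint_left.2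
    fun σ h₁ h₂ => hab ((mem_letterPart.1 h₁).2.symm.trans (mem_letterPart.1 h₂).2)
  have frA : fr ∈ letterPart n M g a := mem_letterPart.2 ⟨mf₂, f₅⟩
  have fqB : fq ∈ letterPart n M g b := mem_letterPart.2 ⟨mf₁, f₂⟩
  have eqA : eq ∈ (letterPart n M g a).erase fr := Finset.mem_erase.2
    ⟨fun E => hbz (by rw [← eb, ← e₀, E, f₃, fz]), mem_letterPart.2 ⟨me₁, e₂⟩⟩
  have erB : er ∈ (letterPart n M g b).erase fq := Finset.mem_erase.2
    ⟨fun E => haz (by rw [← fa, ← f₀, ← E, e₃, ez]), mem_letterPart.2 ⟨me₂, e₅⟩⟩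
  have j₁ := hS.join RotEdge.cyclic tA tB
    (dSA.mono_right (Finset.erase_subset _ _)) (dSB.mono_right (Finset.erase_subset _ _))
    ((dAB.mono_left (Finset.erase_subset _ _)).mono_right (Finset.erase_subset _ _))
    heS eqA erB ⟨M, hM, rfl, rfl⟩
  have j₂ := j₁.join RotEdge.cyclic (isHypertree_singleton fq) (isHypertree_singleton fr)
    (by
      rw [Finset.disjoint_singleton_right]
      simp only [Finset.mem_union, Finset.mem_erase, not_or, not_and]
      exact ⟨⟨Finset.disjoint_right.1 dSB fqB, fun _ => Finset.disjoint_right.1 dAB fqB⟩,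
        fun h => absurd rfl h⟩)
    (by
      rw [Finset.disjoint_singleton_right]
      simp only [Finset.mem_union, Finset.mem_erase, not_or, not_and]
      exact ⟨⟨Finset.disjoint_right.1 dSA frA, fun h => absurd rfl h⟩,
        fun _ => Finset.disjoint_left.1 dAB frA⟩)
    (by
      rw [Finset.disjoint_singleton]
      exact fun E => Finset.disjoint_left.1 dAB frA (E ▸ fqB))
    (Finset.mem_union_left _ (Finset.mem_union_left _ hfS)) (Finset.mem_singleton_self _)
    (Finset.mem_singleton_self _) ⟨M, hM, rfl, rfl⟩
  convert j₂ using 1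
  ext σ
  simp only [Finset.mem_union, Finset.mem_erase, Finset.mem_singleton]
  by_cases h₁ : σ = fq
  · subst h₁; simp [fqB]
  by_cases h₂ : σ = fr
  · rw [h₂]; simp [frA]
  simp [h₁, h₂]

/-- The part of a coset whose entry at the index `M + 2` is in `Z`. -/
def lettersPart (n M : ℕ) (g : Perm (Fin (n + 1))) (Z : Finset (Fin (n + 1))) :
    Finset (Perm (Fin (n + 1))) :=
  (tailCoset n (M + 3) g).filter fun σ => σ (pos n (M + 2)) ∈ Z

theorem mem_lettersPart {Z : Finset (Fin (n + 1))} {σ : Perm (Fin (n + 1))} :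
    σ ∈ lettersPart n M g Z ↔ σ ∈ tailCoset n (M + 3) g ∧ σ (pos n (M + 2)) ∈ Z := by
  simp [lettersPart]

/-- Letters are added two at a time in any order: since the entry of `h` at index `M` is not in `Z`,
no pair from `Z` can be the forbidden one. -/
theorem IsHypertree.add_letters_of_notMem (h2 : 2 ≤ M) (hM : M + 2 < n)
    (ih : ∀ g, IsHypertree (RotEdge n) ((tailCoset n (M + 2) g).erase g))
    {h : Perm (Fin (n + 1))} (hh : h ∈ tailCoset n (M + 3) g) (r : ℕ) :
    ∀ (S : Finset (Perm (Fin (n + 1)))) (Z : Finset (Fin (n + 1))), IsHypertree (RotEdge n) S →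
    Z ⊆ headLetters n (M + 2) g → h (pos n (M + 2)) ∉ Z → h (pos n M) ∉ Z → Z.card = 2 * r →
    (letterPart n M g (h (pos n (M + 2)))).erase h ⊆ S →
    (∀ σ ∈ S, σ (pos n (M + 2)) ∉ Z) → IsHypertree (RotEdge n) (S ∪ lettersPart n M g Z) := by
  induction r with
  | zero =>
    intro S Z hS _ _ _ hc _ _
    rw [Finset.card_eq_zero.1 (by lia : Z.card = 0)]
    simpa [lettersPart] using hS
  | succ r ihr =>
    intro S Z hS hZ hz hx hc hsub hdis
    obtain ⟨a, ha⟩ := Finset.card_pos.1 (by lia : 0 < Z.card)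
    have hc₁ := Finset.card_erase_of_mem ha
    obtain ⟨b, hb⟩ := Finset.card_pos.1 (by lia : 0 < (Z.erase a).card)
    have hc₂ := Finset.card_erase_of_mem hb
    obtain ⟨hba, hbZ⟩ := Finset.mem_erase.1 hb
    have t₁ := hS.add_pair h2 hM ih hh (hZ ha) (hZ hbZ) hba.symm (fun e => hz (e ▸ ha))
      (fun e => hz (e ▸ hbZ)) hsub
      (fun σ hσ => ⟨fun e => hdis σ hσ (e ▸ ha), fun e => hdis σ hσ (e ▸ hbZ)⟩)
      (fun e => hx (e.1 ▸ ha)) (fun e => hx (e.1 ▸ hbZ))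
    have t₂ := ihr _ ((Z.erase a).erase b) t₁
      (fun x hx => hZ (Finset.mem_of_mem_erase (Finset.mem_of_mem_erase hx)))
      (fun H => hz (Finset.mem_of_mem_erase (Finset.mem_of_mem_erase H)))
      (fun H => hx (Finset.mem_of_mem_erase (Finset.mem_of_mem_erase H)))
      (by lia) (hsub.trans (fun x hx => by simp [hx])) (by
        intro σ hσ H
        simp only [Finset.mem_union, mem_letterPart] at hσ
        simp only [Finset.mem_erase] at H
        rcases hσ with (hσ | hσ) | hσ
        · exact hdis σ hσ H.2.2
        · exact H.2.1 hσ.2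
        · exact H.1 hσ.2)
    convert t₂ using 1
    ext σ
    simp only [Finset.mem_union, mem_lettersPart, mem_letterPart, Finset.mem_erase]
    by_cases h₁ : σ (pos n (M + 2)) = a
    · rw [h₁]; simp [ha] ; tauto
    by_cases h₂ : σ (pos n (M + 2)) = b
    · rw [h₂]; simp [hbZ] ; tauto
    simp [h₁, h₂]

/-- Joining an even number of further cosets to a tree. -/
theorem IsHypertree.add_letters (h2 : 2 ≤ M) (hM : M + 2 < n)
    (ih : ∀ g, IsHypertree (RotEdge n) ((tailCoset n (M + 2) g).erase g))
    {h : Perm (Fin (n + 1))} (hh : h ∈ tailCoset n (M + 3) g) {Z : Finset (Fin (n + 1))}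
    (hZ : Z ⊆ headLetters n (M + 2) g) (hz : h (pos n (M + 2)) ∉ Z) (hev : Even Z.card)
    (h4 : 4 ≤ Z.card) :
    IsHypertree (RotEdge n)
      ((letterPart n M g (h (pos n (M + 2)))).erase h ∪ lettersPart n M g Z) := by
  obtain ⟨r, hr⟩ := hev
  have hS : IsHypertree (RotEdge n) ((letterPart n M g (h (pos n (M + 2)))).erase h) := by
    rw [letterPart_eq hM.le hh]; exact ih h
  have hdis : ∀ σ ∈ (letterPart n M g (h (pos n (M + 2)))).erase h, σ (pos n (M + 2)) ∉ Z := by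
    intro σ hσ
    rw [(mem_letterPart.1 (Finset.mem_of_mem_erase hσ)).2]
    exact hz
  by_cases hx : h (pos n M) ∈ Z
  · obtain ⟨b, hb⟩ : ((Z.erase (h (pos n M))).erase (h (pos n (M + 1)))).Nonempty := by
      rw [← Finset.card_pos]
      have h₁ := Finset.card_erase_of_mem hx
      have h₂ := Finset.pred_card_le_card_erase (s := Z.erase (h (pos n M)))
        (a := h (pos n (M + 1)))
      lia
    simp only [Finset.mem_erase] at hb
    obtain ⟨hby, hbx, hbZ⟩ := hb
    have t₁ := hS.add_pair h2 hM ih hh (hZ hx) (hZ hbZ) hbx.symm (fun e => hz (e ▸ hx))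
      (fun e => hz (e ▸ hbZ)) (Finset.Subset.refl _)
      (fun σ hσ => ⟨fun e => hdis σ hσ (e ▸ hx), fun e => hdis σ hσ (e ▸ hbZ)⟩)
      (fun e => hby e.2.symm) (fun e => hbx e.1.symm)
    have hc₁ := Finset.card_erase_of_mem hx
    have hc₂ := Finset.card_erase_of_mem (Finset.mem_erase.2 ⟨hbx, hbZ⟩)
    have t₂ := IsHypertree.add_letters_of_notMem h2 hM ih hh (r - 1) _
      ((Z.erase (h (pos n M))).erase b) t₁
      (fun x hx => hZ (Finset.mem_of_mem_erase (Finset.mem_of_mem_erase hx)))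
      (fun H => hz (Finset.mem_of_mem_erase (Finset.mem_of_mem_erase H)))
      (fun H => by simp at H)
      (by lia) (fun x hx => by simp only [Finset.mem_union]; exact Or.inl (Or.inl hx)) (by
        intro σ hσ H
        simp only [Finset.mem_union, mem_letterPart] at hσ
        simp only [Finset.mem_erase] at H
        rcases hσ with (hσ | hσ) | hσ
        · exact hdis σ hσ H.2.2
        · exact H.2.1 hσ.2
        · exact H.1 hσ.2)
    convert t₂ using 1
    ext σ
    simp only [Finset.mem_union, mem_lettersPart, mem_letterPart, Finset.mem_erase]
    by_cases h₁ : σ (pos n (M + 2)) = h (pos n M)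
    · rw [h₁]; simp [hx] ; tauto
    by_cases h₂ : σ (pos n (M + 2)) = b
    · rw [h₂]; simp [hbZ] ; tauto
    simp [h₁, h₂]
  · exact IsHypertree.add_letters_of_notMem h2 hM ih hh r _ Z hS hZ hz hx (by lia)
      (Finset.Subset.refl _) hdis

end RotTree

section RotTree

variable {n M : ℕ}

theorem tailCoset_three (hn : 2 ≤ n) (h : Perm (Fin (n + 1))) :
    tailCoset n 3 h = {h} ∪ {h * rot3 n 0} ∪ {h * rot3 n 0 * rot3 n 0} := by
  have m₁ := mul_rot3_mem_tailCoset (self_mem_tailCoset (n := n) (N := 3) (g := h)) (j := 0)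
    (by lia) (by lia)
  have m₂ := mul_rot3_mem_tailCoset m₁ (j := 0) (by lia) (by lia)
  have c := two_mul_card_tailCoset (n := n) (N := 3) (by lia) (by lia) h
  obtain ⟨a₀, -, -⟩ := mul_rot3_apply (M := 0) hn h
  obtain ⟨b₀, -, -⟩ := mul_rot3_mul_rot3_apply (M := 0) hn h
  have n₀₁ : h (pos n 0) ≠ h (pos n (0 + 1)) :=
    h.injective.ne (pos_ne (by lia) (by lia) (by lia))
  have n₀₂ : h (pos n 0) ≠ h (pos n (0 + 2)) :=
    h.injective.ne (pos_ne (by lia) (by lia) (by lia))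
  have n₁₂ : h (pos n (0 + 1)) ≠ h (pos n (0 + 2)) :=
    h.injective.ne (pos_ne (by lia) (by lia) (by lia))
  symm
  apply Finset.eq_of_subset_of_card_le
  · intro σ hσ
    simp only [Finset.mem_union, Finset.mem_singleton] at hσ
    rcases hσ with (rfl | rfl) | rfl
    · exact self_mem_tailCoset
    · exact m₁
    · exact m₂
  · rw [Finset.card_union_of_disjoint, Finset.card_union_of_disjoint]
    · simp only [Finset.card_singleton]
      have : Nat.factorial 3 = 6 := rfl
      lia
    · rw [Finset.disjoint_singleton]
      exact fun e => n₀₁ (by rw [← a₀, ← e])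
    · rw [Finset.disjoint_singleton_right]
      simp only [Finset.mem_union, Finset.mem_singleton, not_or]
      exact ⟨fun e => n₀₂ (by rw [← b₀, e]), fun e => n₁₂ (by rw [← a₀, ← b₀, e])⟩

theorem isHypertree_tailCoset_three (hn : 2 < n) (h : Perm (Fin (n + 1))) :
    IsHypertree (RotEdge n) (tailCoset n 3 h) := by
  obtain ⟨a₀, -, -⟩ := mul_rot3_apply (M := 0) hn.le h
  obtain ⟨b₀, -, -⟩ := mul_rot3_mul_rot3_apply (M := 0) hn.le h
  rw [tailCoset_three hn.le]
  refine (isHypertree_singleton h).join RotEdge.cyclic (isHypertree_singleton _)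
    (isHypertree_singleton _) ?_ ?_ ?_ (Finset.mem_singleton_self _) (Finset.mem_singleton_self _)
    (Finset.mem_singleton_self _) ⟨0, hn, rfl, rfl⟩
  · rw [Finset.disjoint_singleton]
    exact fun e => h.injective.ne (pos_ne (i := 0) (j := 1) (by lia) (by lia) (by lia))
      (by rw [← a₀, ← e])
  · rw [Finset.disjoint_singleton]
    exact fun e => h.injective.ne (pos_ne (i := 0) (j := 2) (by lia) (by lia) (by lia))
      (by rw [← b₀, ← e])
  · rw [Finset.disjoint_singleton]
    exact fun e => h.injective.ne (pos_ne (i := 1) (j := 2) (by lia) (by lia) (by lia))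
      (by rw [← a₀, ← b₀, ← e])

theorem disjoint_letterPart {g : Perm (Fin (n + 1))} {a b : Fin (n + 1)} (hab : a ≠ b) :
    Disjoint (letterPart n M g a) (letterPart n M g b) :=
  Finset.disjoint_left.2
    fun _ h₁ h₂ => hab ((mem_letterPart.1 h₁).2.symm.trans (mem_letterPart.1 h₂).2)

-- With three free entries a coset is a single hyperedge, so the general induction step does not
-- apply here. The coset of `g` loses `g` and leaves `s₁` and `s₂`. The triple of `s₁` at index 1
-- joins it to two of the other three cosets; the triple of `s₂` meets one of these two, the third
-- coset and `s₂`. This gives 1 + 3 + 3 + 3 + 1 = 11 vertices.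
set_option maxHeartbeats 1000000 in
theorem isHypertree_tailCoset_four (hn : 3 < n) (g : Perm (Fin (n + 1))) :
    IsHypertree (RotEdge n) ((tailCoset n 4 g).erase g) := by
  obtain ⟨g₀, g₁, g₂⟩ := mul_rot3_apply (M := 0) (by lia) g
  obtain ⟨h₀, h₁, h₂⟩ := mul_rot3_mul_rot3_apply (M := 0) (by lia) g
  have g₃ : (g * rot3 n 0) (pos n 3) = g (pos n 3) := by
    rw [Perm.mul_apply, rot3_apply_pos_of_ne (by lia) (by lia) (by lia) (by lia) (by lia)]
  have h₃ : (g * rot3 n 0 * rot3 n 0) (pos n 3) = g (pos n 3) := by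
    rw [Perm.mul_apply, rot3_apply_pos_of_ne (by lia) (by lia) (by lia) (by lia) (by lia), g₃]
  have ms₁ := mul_rot3_mem_tailCoset (self_mem_tailCoset (n := n) (N := 4) (g := g)) (j := 0)
    (by lia) (by lia)
  have ms₂ := mul_rot3_mem_tailCoset ms₁ (j := 0) (by lia) (by lia)
  set s₁ := g * rot3 n 0 with hs₁
  set s₂ := s₁ * rot3 n 0 with hs₂
  simp only [Nat.zero_add] at g₀ g₁ g₂ h₀ h₁ h₂
  obtain ⟨-, -, x₂⟩ := mul_rot3_apply (M := 1) (by lia) s₁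
  obtain ⟨-, -, x₃⟩ := mul_rot3_mul_rot3_apply (M := 1) (by lia) s₁
  obtain ⟨-, -, y₂⟩ := mul_rot3_apply (M := 1) (by lia) s₂
  obtain ⟨-, -, y₃⟩ := mul_rot3_mul_rot3_apply (M := 1) (by lia) s₂
  have mx₁ := mul_rot3_mem_tailCoset ms₁ (j := 1) (by lia) (by lia)
  have mx₂ := mul_rot3_mem_tailCoset mx₁ (j := 1) (by lia) (by lia)
  have my₁ := mul_rot3_mem_tailCoset ms₂ (j := 1) (by lia) (by lia)
  have my₂ := mul_rot3_mem_tailCoset my₁ (j := 1) (by lia) (by lia)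
  have part : ∀ σ ∈ tailCoset n 4 g,
      IsHypertree (RotEdge n) (letterPart n 1 g (σ (pos n (1 + 2)))) := fun σ hσ => by
    rw [letterPart_eq (by lia) hσ]; exact isHypertree_tailCoset_three (by lia) σ
  have hne : ∀ i j : ℕ, i ≤ 3 → j ≤ 3 → i ≠ j → g (pos n i) ≠ g (pos n j) := fun i j hi hj hij =>
    g.injective.ne (pos_ne (by lia) (by lia) hij)
  have e₀ : letterPart n 1 g (g (pos n 3)) = {g} ∪ {s₁} ∪ {s₂} := by
    rw [← tailCoset_three (by lia)]
    exact letterPart_eq (M := 1) (by lia) self_mem_tailCoset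
  have tx₁ := part _ mx₁
  have tx₂ := part _ mx₂
  have ty₂ := part _ my₂
  have zx₁ := mem_letterPart.2 ⟨mx₁, rfl⟩
  have zx₂ := mem_letterPart.2 ⟨mx₂, rfl⟩
  have zy₁ := mem_letterPart.2 ⟨my₁, rfl⟩
  have zy₂ := mem_letterPart.2 ⟨my₂, rfl⟩
  rw [x₂, g₁] at tx₁ zx₁
  rw [x₃, show (1 + 1 : ℕ) = 2 from rfl, g₂] at tx₂ zx₂
  rw [y₂, h₁] at zy₁
  rw [y₃, show (1 + 1 : ℕ) = 2 from rfl, h₂] at ty₂ zy₂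
  have ns₁ : s₁ ∈ letterPart n 1 g (g (pos n 3)) := mem_letterPart.2 ⟨ms₁, g₃⟩
  have ns₂ : s₂ ∈ letterPart n 1 g (g (pos n 3)) := mem_letterPart.2 ⟨ms₂, h₃⟩
  have hg₁ : g ≠ s₁ := fun e => hne 0 1 (by lia) (by lia) (by lia) (by rw [← g₀, ← e])
  have hg₂ : g ≠ s₂ := fun e => hne 0 2 (by lia) (by lia) (by lia) (by rw [← h₀, ← e])
  have hs₁₂ : s₁ ≠ s₂ := fun e => hne 1 2 (by lia) (by lia) (by lia) (by rw [← g₀, ← h₀, ← e])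
  have j₁ := (isHypertree_singleton s₁).join RotEdge.cyclic tx₁ tx₂
    (Finset.disjoint_singleton_left.2 (Finset.disjoint_left.1
      (disjoint_letterPart (hne 3 2 (by lia) (by lia) (by lia))) ns₁))
    (Finset.disjoint_singleton_left.2 (Finset.disjoint_left.1
      (disjoint_letterPart (hne 3 0 (by lia) (by lia) (by lia))) ns₁))
    (disjoint_letterPart (hne 2 0 (by lia) (by lia) (by lia)))
    (Finset.mem_singleton_self _) zx₁ zx₂ ⟨1, by lia, rfl, rfl⟩
  have j₂ := j₁.join RotEdge.cyclic ty₂ (isHypertree_singleton s₂)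
    (by
      rw [Finset.disjoint_union_left, Finset.disjoint_union_left, Finset.disjoint_singleton_left]
      exact ⟨⟨Finset.disjoint_left.1
        (disjoint_letterPart (hne 3 1 (by lia) (by lia) (by lia))) ns₁,
        disjoint_letterPart (hne 2 1 (by lia) (by lia) (by lia))⟩,
        disjoint_letterPart (hne 0 1 (by lia) (by lia) (by lia))⟩)
    (by
      rw [Finset.disjoint_singleton_right]
      simp only [Finset.mem_union, Finset.mem_singleton, not_or]
      exact ⟨⟨hs₁₂.symm, Finset.disjoint_left.1
        (disjoint_letterPart (hne 3 2 (by lia) (by lia) (by lia))) ns₂⟩,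
        Finset.disjoint_left.1
        (disjoint_letterPart (hne 3 0 (by lia) (by lia) (by lia))) ns₂⟩)
    (Finset.disjoint_singleton_right.2 (Finset.disjoint_left.1
      (disjoint_letterPart (hne 3 1 (by lia) (by lia) (by lia))) ns₂))
    (Finset.mem_union_right _ zy₁) zy₂ (Finset.mem_singleton_self _)
    (RotEdge.cyclic _ _ _ ⟨1, by lia, rfl, rfl⟩)
  convert j₂ using 1
  ext σ
  have hdec : σ ∈ tailCoset n 4 g ↔ σ ∈ letterPart n 1 g (g (pos n 0)) ∨
      σ ∈ letterPart n 1 g (g (pos n 1)) ∨ σ ∈ letterPart n 1 g (g (pos n 2)) ∨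
      σ ∈ letterPart n 1 g (g (pos n 3)) := by
    simp only [mem_letterPart]
    refine ⟨fun hσ => ?_, by tauto⟩
    have h₄ := (apply_mem_headLetters hσ (p := pos n 3)).2 (pos_val (by lia)).le
    rw [mem_headLetters] at h₄
    have h₅ : σ (pos n 3) = g (pos n (g⁻¹ (σ (pos n 3))).val) := by
      rw [pos_val_self, perm_apply_inv]
    have : (g⁻¹ (σ (pos n 3))).val = 0 ∨ (g⁻¹ (σ (pos n 3))).val = 1 ∨
      (g⁻¹ (σ (pos n 3))).val = 2 ∨ (g⁻¹ (σ (pos n 3))).val = 3 := by lia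
    rcases this with h | h | h | h <;> rw [h] at h₅
    · exact Or.inl ⟨hσ, h₅⟩
    · exact Or.inr (Or.inl ⟨hσ, h₅⟩)
    · exact Or.inr (Or.inr (Or.inl ⟨hσ, h₅⟩))
    · exact Or.inr (Or.inr (Or.inr ⟨hσ, h₅⟩))
  have hg : ∀ i, i < 3 → g ∉ letterPart n 1 g (g (pos n i)) := fun i hi hmem =>
    hne 3 i (by lia) (by lia) (by lia) (mem_letterPart.1 hmem).2
  rw [Finset.mem_erase, hdec, e₀]
  simp only [Finset.mem_union, Finset.mem_singleton]
  by_cases e : σ = g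
  · simp [e, hg₁, hg₂, hg 0 (by lia), hg 1 (by lia), hg 2 (by lia)]
  · simp only [ne_eq, e, not_false_eq_true, true_and, false_or]
    clear * -
    tauto

/-- All but one of the even arrangements of the first `N` entries form a tree. -/
theorem isHypertree_tailCoset_erase {N : ℕ} (h4 : 4 ≤ N) (hN : N ≤ n)
    (g : Perm (Fin (n + 1))) : IsHypertree (RotEdge n) ((tailCoset n N g).erase g) := by
  induction N, h4 using Nat.le_induction generalizing g with
  | base => exact isHypertree_tailCoset_four (by lia) g
  | succ N h4 ih =>
    obtain ⟨M, rfl⟩ : ∃ M, N = M + 2 := ⟨N - 2, by lia⟩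
    have ih' := ih (by lia)
    have hL := card_headLetters (g := g) (N := M + 2) (n := n) (by lia)
    have hg : g (pos n (M + 2)) ∈ headLetters n (M + 2) g :=
      (apply_mem_headLetters self_mem_tailCoset).2 (pos_val (by lia)).le
    have hc := Finset.card_erase_of_mem hg
    -- Cosets are added in pairs. For even `M` an even number of letters remains besides the last
    -- free entry of `g`, and one call is enough. For odd `M` one coset is left over: a tree that
    -- misses a vertex `h` is built without the coset of `g`, and a final hyperedge joins it to that
    -- coset without `g` and to `h`.
    rcases Nat.even_or_odd M with hM | hM
    · have t := IsHypertree.add_letters (g := g) (by lia) (by lia) ih' self_mem_tailCoset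
        (Finset.erase_subset (g (pos n (M + 2))) _) (Finset.notMem_erase _ _)
        (by rw [hc, hL]; exact hM.add (by decide)) (by lia)
      convert t using 1
      ext σ
      simp only [Finset.mem_erase, Finset.mem_union, mem_letterPart, mem_lettersPart]
      by_cases hσ : σ ∈ tailCoset n (M + 3) g
      · have := (apply_mem_headLetters hσ (p := pos n (M + 2))).2 (pos_val (by lia)).le
        by_cases e : σ (pos n (M + 2)) = g (pos n (M + 2))
        · simp [hσ, e]
        · have : σ ≠ g := fun h => e (by rw [h])
          simp_all
      · simp [hσ]
    · obtain ⟨r, hr⟩ := hM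
      -- The final hyperedge must start in the coset of `g`, but not at `g`, so `g` is first rotated
      -- at indices 0, 1, 2, which do not affect the last free entry.
      have mu := mul_rot3_mem_tailCoset (self_mem_tailCoset (n := n) (N := M + 3) (g := g))
        (j := 0) (by lia) (by lia)
      have hug : g * rot3 n 0 ≠ g := fun e =>
        g.injective.ne (pos_ne (n := n) (i := 1) (j := 0) (by lia) (by lia) (by lia))
          (by rw [← (mul_rot3_apply (M := 0) (by lia) g).1, e])
      have hu : (g * rot3 n 0) (pos n (M + 2)) = g (pos n (M + 2)) := by
        rw [Perm.mul_apply, rot3_apply_pos_of_ne (by lia) (by lia) (by lia) (by lia) (by lia)]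
      set u := g * rot3 n 0 with hu_def
      obtain ⟨-, a₁, a₂⟩ := mul_rot3_apply (M := M) (by lia) u
      obtain ⟨-, -, b₂⟩ := mul_rot3_mul_rot3_apply (M := M) (by lia) u
      have mh := mul_rot3_mem_tailCoset mu (j := M) (by lia) (by lia)
      have mv := mul_rot3_mem_tailCoset mh (j := M) (by lia) (by lia)
      set h := u * rot3 n M with hh_def
      have hz : h (pos n (M + 2)) ≠ g (pos n (M + 2)) := by
        rw [a₂, ← hu]; exact u.injective.ne (pos_ne (by lia) (by lia) (by lia))
      have hvz : (h * rot3 n M) (pos n (M + 2)) ≠ h (pos n (M + 2)) := by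
        rw [b₂, a₂]; exact u.injective.ne (pos_ne (by lia) (by lia) (by lia))
      have hvg : (h * rot3 n M) (pos n (M + 2)) ≠ g (pos n (M + 2)) := by
        rw [b₂, ← hu]; exact u.injective.ne (pos_ne (by lia) (by lia) (by lia))
      have hhL := (apply_mem_headLetters mh (p := pos n (M + 2))).2 (pos_val (by lia)).le
      have hvL := (apply_mem_headLetters mv (p := pos n (M + 2))).2 (pos_val (by lia)).le
      have hc₂ := Finset.card_erase_of_mem (Finset.mem_erase.2 ⟨hz, hhL⟩)
      have t := IsHypertree.add_letters (g := g) (by lia) (by lia) ih' mh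
        (Z := ((headLetters n (M + 2) g).erase (g (pos n (M + 2)))).erase (h (pos n (M + 2))))
        ((Finset.erase_subset _ _).trans (Finset.erase_subset _ _)) (Finset.notMem_erase _ _)
        ⟨r + 1, by lia⟩ (by lia)
      have tg := ih' g
      rw [← letterPart_eq (g := g) (by lia) self_mem_tailCoset] at tg
      have j := t.join RotEdge.cyclic tg (isHypertree_singleton h)
        (by
          rw [Finset.disjoint_left]
          intro σ h₁ h₂
          simp only [Finset.mem_union, Finset.mem_erase, mem_letterPart, mem_lettersPart] at h₁ h₂
          rcases h₁ with h₁ | h₁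
          · exact hz (h₁.2.2.symm.trans h₂.2.2)
          · exact h₁.2.2.1 h₂.2.2)
        (by
          rw [Finset.disjoint_singleton_right]
          simp [mem_lettersPart])
        (by
          rw [Finset.disjoint_singleton_right]
          simp only [Finset.mem_erase, mem_letterPart]
          exact fun H => hz H.2.2)
        (v₁ := h * rot3 n M) (v₂ := u) (v₃ := h)
        (Finset.mem_union_right _ (mem_lettersPart.2
          ⟨mv, Finset.mem_erase.2 ⟨hvz, Finset.mem_erase.2 ⟨hvg, hvL⟩⟩⟩))
        (Finset.mem_erase.2 ⟨hug, mem_letterPart.2 ⟨mu, hu⟩⟩)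
        (Finset.mem_singleton_self _)
        (RotEdge.cyclic _ _ _ (RotEdge.cyclic _ _ _ ⟨M, by lia, rfl, rfl⟩))
      convert j using 1
      ext σ
      simp only [Finset.mem_erase, Finset.mem_union, mem_letterPart, mem_lettersPart,
        Finset.mem_singleton]
      by_cases e' : σ = h
      · rw [e']
        have : h ≠ g := fun e => hz (by rw [e])
        simp [this, mh]
      by_cases hσ : σ ∈ tailCoset n (M + 3) g
      · have hm := (apply_mem_headLetters hσ (p := pos n (M + 2))).2 (pos_val (by lia)).le
        by_cases e : σ (pos n (M + 2)) = g (pos n (M + 2))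
        · simp [hσ, e, e', hz.symm]
        · have : σ ≠ g := fun h => e (by rw [h])
          by_cases e₂ : σ (pos n (M + 2)) = h (pos n (M + 2))
          · simp [hσ, hz, e', this, e₂]
          · simp [hσ, e, e', hm, this, e₂]
      · simp [hσ, e']

/-- The even arrangements of the first `M + 3` entries whose last entry is not `z₀`, but for an
arbitrary one of them, form a tree. -/
theorem isHypertree_erase_letter (hM : Odd M) (h3 : 3 ≤ M) (hn : M + 2 < n)
    {g h : Perm (Fin (n + 1))} {z₀ : Fin (n + 1)} (hz₀ : z₀ ∈ headLetters n (M + 2) g)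
    (hh : h ∈ (tailCoset n (M + 3) g).filter fun σ => σ (pos n (M + 2)) ≠ z₀) :
    IsHypertree (RotEdge n)
      (((tailCoset n (M + 3) g).filter fun σ => σ (pos n (M + 2)) ≠ z₀).erase h) := by
  obtain ⟨mh, hz⟩ := Finset.mem_filter.1 hh
  obtain ⟨r, hr⟩ := hM
  have hL := card_headLetters (g := g) (N := M + 2) (n := n) (by lia)
  have hc := Finset.card_erase_of_mem hz₀
  have hhL := (apply_mem_headLetters mh (p := pos n (M + 2))).2 (pos_val (by lia)).le
  have hc₂ := Finset.card_erase_of_mem (Finset.mem_erase.2 ⟨hz, hhL⟩)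
  have t := IsHypertree.add_letters (g := g) (by lia) hn
    (fun g => isHypertree_tailCoset_erase (by lia) (by lia) g) mh
    (Z := ((headLetters n (M + 2) g).erase z₀).erase (h (pos n (M + 2))))
    ((Finset.erase_subset _ _).trans (Finset.erase_subset _ _)) (Finset.notMem_erase _ _)
    ⟨r + 1, by lia⟩ (by lia)
  convert t using 1
  ext σ
  simp only [Finset.mem_erase, Finset.mem_union, mem_letterPart, mem_lettersPart,
    Finset.mem_filter]
  by_cases hσ : σ ∈ tailCoset n (M + 3) g
  · have hm := (apply_mem_headLetters hσ (p := pos n (M + 2))).2 (pos_val (by lia)).le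
    by_cases e : σ (pos n (M + 2)) = h (pos n (M + 2))
    · simp [hσ, e, hz]
    · have : σ ≠ h := fun h => e (by rw [h])
      simp [hσ, e, hm, this]
  · simp [hσ]

theorem two_mul_card_erase_letter (hn : M + 2 < n) {g : Perm (Fin (n + 1))} {z₀ : Fin (n + 1)}
    (hz₀ : z₀ ∈ headLetters n (M + 2) g) :
    2 * ((tailCoset n (M + 3) g).filter fun σ => σ (pos n (M + 2)) ≠ z₀).card =
      (M + 2) * (M + 2).factorial := by
  have h₁ := two_mul_card_tailCoset (n := n) (N := M + 3) (by lia) (by lia) g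
  obtain ⟨σ, t, u, -⟩ := exists_agree_apply_eq (N := M + 2) (by lia) le_rfl (fun _ _ => rfl) hz₀
  obtain ⟨e, he, hf⟩ := exists_mem_tailCoset_agree (N := M + 3) (by lia) (by lia) t
  have h₂ := two_mul_card_tailCoset (n := n) (N := M + 2) (by lia) (by lia) e
  rw [← tailCoset_succ_filter (by lia) he, hf _ (by rw [pos_val (by lia)]; lia), u] at h₂
  have h₃ := Finset.card_filter_add_card_filter_not (s := tailCoset n (M + 3) g)
    (fun σ => σ (pos n (M + 2)) = z₀)
  have h₄ : (M + 3).factorial = (M + 2) * (M + 2).factorial + (M + 2).factorial := by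
    rw [Nat.factorial_succ]; ring
  simp only [ne_eq]
  rw [show M + 2 + 1 = M + 3 from rfl] at h₂
  lia

end RotTree

/-! ### Transitions and shift cycles -/

/-- The position permutation of the "push-to-the-top" transition on the index `j`. -/
def top (n j : ℕ) : Perm (Fin (n + 1)) := (Fin.cycleIcc 0 (pos n j))⁻¹

theorem top_val {n j : ℕ} (hj : j ≤ n) (p : Fin (n + 1)) :
    (top n j p).val = if p.val = 0 then j else if p.val ≤ j then p.val - 1 else p.val := by
  have h₁ : top n j = pushToIndex 0 (pos n j) 1 := by rw [pushToIndex, one_mul]; rfl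
  rw [h₁]
  split_ifs with h₀ h₂
  · have : p = 0 := Fin.ext h₀
    rw [this, pushToIndex_apply_target (Fin.zero_le _), Perm.one_apply, pos_val hj]
  · have hp : p = pos n (p.val - 1) + 1 := by
      apply Fin.ext
      have hlt : pos n (p.val - 1) < Fin.last n := by
        rw [Fin.lt_def, pos_val (by lia), Fin.val_last]; lia
      rw [Fin.val_add_one_of_lt hlt, pos_val (by lia)]
      lia
    conv_lhs => rw [hp]
    rw [pushToIndex_apply_between (Fin.zero_le _) (by rw [Fin.lt_def, pos_val, pos_val] <;> lia),
      Perm.one_apply, pos_val (by lia)]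
  · rw [pushToIndex_apply_outside (Or.inr (by rw [Fin.lt_def, pos_val] <;> lia)), Perm.one_apply]

theorem sign_top {n j : ℕ} (hj : j ≤ n) : Perm.sign (top n j) = (-1) ^ j := by
  rw [top, Perm.sign_inv, Fin.sign_cycleIcc_of_le (Fin.zero_le _), pos_val hj]
  rfl

theorem rot3_val {n j : ℕ} (hj : j + 2 ≤ n) (p : Fin (n + 1)) :
    (rot3 n j p).val = if p.val = j then j + 1 else if p.val = j + 1 then j + 2
      else if p.val = j + 2 then j else p.val := by
  split_ifs with h₀ h₁ h₂
  · rw [← pos_val_self p, h₀, rot3_apply_zero hj, pos_val (by lia)]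
  · rw [← pos_val_self p, h₁, rot3_apply_one hj, pos_val (by lia)]
  · rw [← pos_val_self p, h₂, rot3_apply_two, pos_val (by lia)]
  · rw [rot3_apply_of_ne hj h₀ h₁ h₂]

/-- One permutation is obtained from another by a "push-to-the-top" transition. -/
def PushStep {n : ℕ} (σ τ : Perm (Fin (n + 1))) : Prop :=
  ∃ j : Fin (n + 1), 0 < j ∧ τ = pushToIndex 0 j σ

theorem pushStep_mul_top {n j : ℕ} (h0 : 0 < j) (hj : j ≤ n) (σ : Perm (Fin (n + 1))) :
    PushStep σ (σ * top n j) :=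
  ⟨pos n j, by rw [Fin.lt_def, pos_val hj]; exact h0, rfl⟩

section ring

variable {n : ℕ}

/-- The permutation of the positions which shifts the first `n` entries cyclically. -/
def shift (n : ℕ) : Perm (Fin (n + 1)) := top n (n - 1)

theorem shift_val (p : Fin (n + 1)) :
    (shift n p).val = if p.val = 0 then n - 1 else if p.val ≤ n - 1 then p.val - 1 else p.val :=
  top_val (by lia) p

theorem shift_pow_val (hn : 1 ≤ n) (p : Fin (n + 1)) (i : ℕ) (hi : i ≤ n) :
    ((shift n ^ i) p).val =
      if p.val = n then n else if i ≤ p.val then p.val - i else p.val + n - i := by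
  induction i with
  | zero => simp only [pow_zero, Perm.one_apply]; split_ifs <;> lia
  | succ i ih =>
    rw [pow_succ', Perm.mul_apply, shift_val, ih (by lia)]
    have := p.isLt
    split_ifs <;> lia

theorem shift_pow_self (hn : 1 ≤ n) : shift n ^ n = 1 := by
  ext p
  rw [shift_pow_val hn p n le_rfl, Perm.one_apply]
  have := p.isLt
  split_ifs <;> lia

theorem shift_pow_mod (hn : 1 ≤ n) (i : ℕ) : shift n ^ i = shift n ^ (i % n) := by
  conv_lhs => rw [← Nat.div_add_mod i n, pow_add, pow_mul, shift_pow_self hn, one_pow, one_mul]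

theorem shift_pow_eq_one (hn : 1 ≤ n) {i : ℕ} (h : (shift n ^ i) (pos n (n - 1)) = pos n (n - 1)) :
    shift n ^ i = 1 := by
  rw [shift_pow_mod hn] at h ⊢
  have h₁ := Nat.mod_lt i hn
  have h₂ := shift_pow_val hn (pos n (n - 1)) (i % n) h₁.le
  rw [h, pos_val (by lia)] at h₂
  have : i % n = 0 := by split_ifs at h₂ <;> lia
  rw [this, pow_zero]

theorem shift_pow_inj (hn : 1 ≤ n) {i j : ℕ} (hi : i < n) (hj : j < n)
    (h : shift n ^ i = shift n ^ j) : i = j := by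
  have h₁ := shift_pow_val hn (pos n (n - 1)) i hi.le
  rw [h, shift_pow_val hn (pos n (n - 1)) j hj.le, pos_val (by lia)] at h₁
  split_ifs at h₁ <;> lia

/-- This makes detours possible: a transition other than the shift leads from `u` into the shift
cycle of the rotated `u`. -/
theorem top_sub_three (hn : 3 ≤ n) : top n (n - 3) = rot3 n (n - 3) * shift n := by
  ext p
  rw [Perm.mul_apply, top_val (by lia), rot3_val (by lia), shift_val]
  have := p.isLt
  split_ifs <;> lia

theorem rot3_mul_shift {j : ℕ} (hj : j + 4 ≤ n) :
    rot3 n j * shift n = shift n * rot3 n (j + 1) := by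
  ext p
  rw [Perm.mul_apply, Perm.mul_apply, shift_val, rot3_val (by lia), rot3_val (by lia), shift_val]
  have := p.isLt
  split_ifs <;> lia

/-- Passing to another member of a shift cycle moves the rotation along the indices. All hyperedges
are thereby reduced to the rotation at `n - 3`. -/
theorem rot3_mul_shift_pow {j c : ℕ} (h : j + c + 3 ≤ n) :
    rot3 n j * shift n ^ c = shift n ^ c * rot3 n (j + c) := by
  induction c with
  | zero => simp
  | succ c ih =>
    rw [pow_succ, ← mul_assoc, ih (by lia), mul_assoc, rot3_mul_shift (by lia), mul_assoc,
      add_assoc]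

theorem mul_shift_pow_mul_pow (hn : 1 ≤ n) (σ : Perm (Fin (n + 1))) (i : ℕ) :
    ∃ j, σ * shift n ^ i * shift n ^ j = σ := by
  refine ⟨n - i % n, ?_⟩
  have := Nat.mod_lt i hn
  rw [shift_pow_mod hn i, mul_assoc, ← pow_add, show i % n + (n - i % n) = n by lia,
    shift_pow_self hn, mul_one]

/-- The cycle of shifts of `v`, ending with `v`. -/
def ringList (n : ℕ) (v : Perm (Fin (n + 1))) : List (Perm (Fin (n + 1))) :=
  (List.range n).map fun i => v * shift n ^ (i + 1)

theorem mem_ringList (hn : 1 ≤ n) {v σ : Perm (Fin (n + 1))} :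
    σ ∈ ringList n v ↔ ∃ i, σ = v * shift n ^ i := by
  simp only [ringList, List.mem_map, List.mem_range]
  constructor
  · rintro ⟨i, -, rfl⟩
    exact ⟨i + 1, rfl⟩
  · rintro ⟨i, rfl⟩
    refine ⟨(i + n - 1) % n, Nat.mod_lt _ hn, ?_⟩
    rw [shift_pow_mod hn (_ + 1), shift_pow_mod hn i, Nat.mod_add_mod,
      show i + n - 1 + 1 = i + n by lia, Nat.add_mod_right]

theorem length_ringList (v : Perm (Fin (n + 1))) : (ringList n v).length = n := by
  simp [ringList]

theorem nodup_ringList (hn : 1 ≤ n) (v : Perm (Fin (n + 1))) : (ringList n v).Nodup := by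
  refine List.nodup_range.map_on fun i hi j hj h => ?_
  rw [pow_succ, pow_succ, ← mul_assoc, ← mul_assoc] at h
  exact shift_pow_inj hn (List.mem_range.1 hi) (List.mem_range.1 hj)
    (mul_left_cancel (mul_right_cancel h))

theorem isChain_ringList (hn : 2 ≤ n) (v : Perm (Fin (n + 1))) :
    (ringList n v).IsChain PushStep := by
  rw [List.isChain_iff_getElem]
  intro i hi
  simp only [ringList, List.getElem_map, List.getElem_range]
  rw [pow_succ _ (i + 1), ← mul_assoc]
  exact pushStep_mul_top (by lia) (by lia) _

theorem ringList_eq_cons (hn : 1 ≤ n) (v : Perm (Fin (n + 1))) :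
    ∃ l, ringList n v = v * shift n :: l := by
  obtain ⟨m, rfl⟩ : ∃ m, n = m + 1 := ⟨n - 1, by lia⟩
  exact ⟨_, by rw [ringList, List.range_succ_eq_map, List.map_cons, zero_add, pow_one]⟩

theorem ringList_eq_append (hn : 1 ≤ n) (v : Perm (Fin (n + 1))) :
    ∃ l, ringList n v = l ++ [v] := by
  refine ⟨(List.range (n - 1)).map fun i => v * shift n ^ (i + 1), ?_⟩
  have : List.range n = List.range (n - 1) ++ [n - 1] := by
    rw [← List.range_succ, show (n - 1).succ = n by lia]
  rw [ringList, this, List.map_append, List.map_singleton, show n - 1 + 1 = n by lia,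
    shift_pow_self hn, mul_one]

end ring

/-! ### Paths as lists and insertion of detours -/

/-- `x` is immediately followed by `y` in the list `l`. -/
def Follows {α : Type*} (x y : α) (l : List α) : Prop := ∃ l₁ l₂, l = l₁ ++ x :: y :: l₂

section Follows

variable {α : Type*} {x y : α} {l m : List α}

theorem Follows.append_right (h : Follows x y l) (m : List α) : Follows x y (l ++ m) := by
  obtain ⟨l₁, l₂, rfl⟩ := h
  exact ⟨l₁, l₂ ++ m, by simp⟩

theorem Follows.append_left (h : Follows x y l) (m : List α) : Follows x y (m ++ l) := by
  obtain ⟨l₁, l₂, rfl⟩ := h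
  exact ⟨m ++ l₁, l₂, by simp⟩

theorem Follows.of_append_of_ne {u : α} (h : Follows x y (l ++ u :: m)) (hx : x ≠ u) :
    Follows x y (l ++ [u]) ∨ Follows x y m := by
  obtain ⟨p, q, h⟩ := h
  rw [show l ++ u :: m = (l ++ [u]) ++ m by simp] at h
  rcases List.append_eq_append_iff.1 h with ⟨c, rfl, hc⟩ | ⟨c, hA, hc⟩
  · exact Or.inr ⟨c, q, hc⟩
  · match c, hA, hc with
    | [], _, hc => exact Or.inr ⟨[], q, by simpa using hc.symm⟩
    | [z], hA, hc =>
      simp only [List.cons_append, List.nil_append, List.cons.injEq] at hc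
      have := congrArg List.getLast? hA
      simp only [List.getLast?_append, List.getLast?_singleton, Option.some_or,
        Option.some.injEq] at this
      exact absurd (hc.1.trans this.symm) hx
    | z :: w :: r, hA, hc =>
      simp only [List.cons_append, List.cons.injEq] at hc
      obtain ⟨rfl, rfl, -⟩ := hc
      exact Or.inl ⟨p, r, hA⟩

/-- Only the step out of `u` is broken by the insertion, so the other steps remain available for
later detours. -/
theorem Follows.insert {u v : α} (h : Follows x y (l ++ u :: v :: m)) (hx : x ≠ u)
    (M : List α) : Follows x y (l ++ u :: (M ++ v :: m)) := by
  rcases h.of_append_of_ne hx with h | h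
  · have := h.append_right (M ++ v :: m)
    rwa [List.append_assoc, List.singleton_append] at this
  · have := (h.append_left M).append_left (l ++ [u])
    rwa [List.append_assoc, List.singleton_append] at this

end Follows

theorem follows_ringList {n : ℕ} (hn : 1 ≤ n) {v : Perm (Fin (n + 1))} {i : ℕ}
    (h : v * shift n ^ i ≠ v) :
    Follows (v * shift n ^ i) (v * shift n ^ i * shift n) (ringList n v) := by
  have hlt := Nat.mod_lt i hn
  have h0 : i % n ≠ 0 := fun e => h (by rw [shift_pow_mod hn, e, pow_zero, mul_one])
  rw [shift_pow_mod hn i]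
  refine ⟨(ringList n v).take (i % n - 1), (ringList n v).drop (i % n + 1), ?_⟩
  have e₁ : (ringList n v).drop (i % n - 1) =
      v * shift n ^ (i % n) :: v * shift n ^ (i % n) * shift n :: (ringList n v).drop (i % n + 1) := by
    rw [List.drop_eq_getElem_cons (by rw [length_ringList]; lia),
      List.drop_eq_getElem_cons (by rw [length_ringList]; lia),
      show i % n - 1 + 1 + 1 = i % n + 1 by lia]
    simp only [ringList, List.getElem_map, List.getElem_range]
    rw [show i % n - 1 + 1 = i % n by lia, pow_succ, mul_assoc]
  rw [← e₁, List.take_append_drop]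

/-- A list without repetitions from `x` to `y` whose steps are transitions. -/
structure IsPushPath {n : ℕ} (x y : Perm (Fin (n + 1))) (l : List (Perm (Fin (n + 1)))) :
    Prop where
  chain : l.IsChain PushStep
  nodup : l.Nodup
  head : l.head? = some x
  last : l.getLast? = some y

theorem IsPushPath.append {n : ℕ} {x y x' y' : Perm (Fin (n + 1))}
    {l l' : List (Perm (Fin (n + 1)))} (h : IsPushPath x y l) (h' : IsPushPath x' y' l')
    (hs : PushStep y x') (hd : List.Disjoint l l') : IsPushPath x y' (l ++ l') where
  chain := by
    rw [List.isChain_append]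
    refine ⟨h.chain, h'.chain, fun a ha b hb => ?_⟩
    rw [h.last] at ha; rw [h'.head] at hb
    obtain rfl := Option.some.inj ha
    obtain rfl := Option.some.inj hb
    exact hs
  nodup := List.nodup_append'.2 ⟨h.nodup, h'.nodup, hd⟩
  head := by rw [List.head?_append, h.head]; rfl
  last := by rw [List.getLast?_append, h'.last]; rfl

theorem isPushPath_ringList {n : ℕ} (hn : 2 ≤ n) (v : Perm (Fin (n + 1))) :
    IsPushPath (v * shift n) v (ringList n v) where
  chain := isChain_ringList hn v
  nodup := nodup_ringList (by lia) v
  head := by obtain ⟨l, hl⟩ := ringList_eq_cons (by lia) v; rw [hl]; rfl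
  last := by obtain ⟨l, hl⟩ := ringList_eq_append (by lia) v; rw [hl]; simp

theorem IsPushPath.insert {n : ℕ} {x y a b u w : Perm (Fin (n + 1))}
    {l₁ l₂ M : List (Perm (Fin (n + 1)))} (h : IsPushPath x y (l₁ ++ u :: w :: l₂))
    (hM : IsPushPath a b M) (h₁ : PushStep u a) (h₂ : PushStep b w)
    (hd : List.Disjoint (l₁ ++ u :: w :: l₂) M) :
    IsPushPath x y (l₁ ++ u :: (M ++ w :: l₂)) where
  chain := by
    have hc := h.chain
    rw [List.isChain_append_cons_cons] at hc
    have e : l₁ ++ u :: (M ++ w :: l₂) = (l₁ ++ [u]) ++ (M ++ w :: l₂) := by simp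
    rw [e]
    refine List.isChain_append.2 ⟨hc.1, List.isChain_append.2
      ⟨hM.chain, hc.2.2, fun c hc' d hd' => ?_⟩, fun c hc' d hd' => ?_⟩
    · rw [hM.last] at hc'
      obtain rfl := Option.some.inj hc'
      obtain rfl := Option.some.inj hd'
      exact h₂
    · rw [List.head?_append, hM.head] at hd'
      obtain rfl := Option.some.inj hd'
      simp only [List.getLast?_append, List.getLast?_singleton, Option.some_or] at hc'
      obtain rfl := Option.some.inj hc'
      exact h₁
  nodup := by
    have hn := List.nodup_append'.2 ⟨hM.nodup, h.nodup, hd.symm⟩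
    refine (List.Perm.nodup_iff ?_).1 hn
    have e : l₁ ++ u :: w :: l₂ = (l₁ ++ [u]) ++ w :: l₂ := by simp
    have e' : l₁ ++ u :: (M ++ w :: l₂) = (l₁ ++ [u]) ++ (M ++ w :: l₂) := by simp
    rw [e, e']
    exact (List.perm_append_comm_assoc _ _ _)
  head := by
    rw [← h.head]
    cases l₁ <;> simp
  last := by
    have e : l₁ ++ u :: w :: l₂ = (l₁ ++ [u]) ++ w :: l₂ := by simp
    have e' : l₁ ++ u :: (M ++ w :: l₂) = (l₁ ++ [u] ++ M) ++ w :: l₂ := by simp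
    rw [← h.last, e, e', List.getLast?_append_cons, List.getLast?_append_cons]

/-! ### Gluing shift cycles along a tree -/

section Gluing

variable {n : ℕ}

/-- The detour runs through the cycle list of b = uQ and then that of c = uQ². Each starts at the
shift of its label and ends at the label, so the transition QT leads from u into the first, from b
into the second, and from c back to uT because Q³ = 1. The last two clauses record which shift steps
survive. -/
theorem exists_glued_path (hn : 4 ≤ n) {x y u : Perm (Fin (n + 1))}
    {l : List (Perm (Fin (n + 1)))} (h : IsPushPath x y l) (hu : Follows u (u * shift n) l)
    (hb : ∀ i, u * rot3 n (n - 3) * shift n ^ i ∉ l)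
    (hc : ∀ i, u * rot3 n (n - 3) * rot3 n (n - 3) * shift n ^ i ∉ l)
    (hbc : ∀ i, u * rot3 n (n - 3) * rot3 n (n - 3) ≠ u * rot3 n (n - 3) * shift n ^ i) :
    ∃ l', IsPushPath x y l' ∧ l'.length = l.length + 2 * n ∧
      (∀ σ, σ ∈ l' ↔ σ ∈ l ∨ (∃ i, σ = u * rot3 n (n - 3) * shift n ^ i) ∨
        ∃ i, σ = u * rot3 n (n - 3) * rot3 n (n - 3) * shift n ^ i) ∧
      (∀ z, z ≠ u → Follows z (z * shift n) l → Follows z (z * shift n) l') ∧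
      (∀ v, v = u * rot3 n (n - 3) ∨ v = u * rot3 n (n - 3) * rot3 n (n - 3) →
        ∀ i, v * shift n ^ i ≠ v → Follows (v * shift n ^ i) (v * shift n ^ i * shift n) l') := by
  obtain ⟨l₁, l₂, rfl⟩ := hu
  set b := u * rot3 n (n - 3) with hb'
  set c := b * rot3 n (n - 3) with hc'
  have hcu : c * rot3 n (n - 3) = u := by
    have := rot3_mul_rot3_mul_rot3 (n := n) (j := n - 3) (by lia)
    rw [hc', hb', mul_assoc, mul_assoc, ← mul_assoc (rot3 n (n - 3)), this, mul_one]
  have push : ∀ z, PushStep z (z * rot3 n (n - 3) * shift n) := fun z => by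
    rw [mul_assoc, ← top_sub_three (by lia)]
    exact pushStep_mul_top (by lia) (by lia) z
  have hM := (isPushPath_ringList (by lia) b).append (isPushPath_ringList (by lia) c) (push b)
    (by
      intro σ h₁ h₂
      obtain ⟨i, rfl⟩ := (mem_ringList (by lia)).1 h₁
      obtain ⟨j, hj⟩ := (mem_ringList (by lia)).1 h₂
      obtain ⟨k, hk⟩ := mul_shift_pow_mul_pow (n := n) (by lia) c j
      rw [← hj, mul_assoc, ← pow_add] at hk
      exact hbc _ hk.symm)
  have hP := h.insert hM (push u) (by have := push c; rwa [hcu] at this) (by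
      intro σ h₁ h₂
      rcases List.mem_append.1 h₂ with h₂ | h₂
      · obtain ⟨i, rfl⟩ := (mem_ringList (by lia)).1 h₂
        exact hb i h₁
      · obtain ⟨i, rfl⟩ := (mem_ringList (by lia)).1 h₂
        exact hc i h₁)
  refine ⟨_, hP, ?_, ?_, ?_, ?_⟩
  · simp only [List.length_append, List.length_cons, length_ringList]
    lia
  · intro σ
    rw [← mem_ringList (by lia), ← mem_ringList (by lia)]
    simp only [List.mem_append, List.mem_cons]
    tauto
  · intro z hz hf
    exact hf.insert hz _
  · intro v hv i hi
    have hf := follows_ringList (by lia) hi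
    rcases hv with rfl | rfl
    · have := ((hf.append_right (ringList n c)).append_right (u * shift n :: l₂)).append_left
        (l₁ ++ [u])
      rwa [List.append_assoc, List.singleton_append] at this
    · have := ((hf.append_left (ringList n b)).append_right (u * shift n :: l₂)).append_left
        (l₁ ++ [u])
      rwa [List.append_assoc, List.singleton_append] at this

/-- A path can be extended along a tree of shift cycles which is attached to one of its shifts. -/
theorem exists_path_of_grows (hn : 4 ≤ n) {x y u v o : Perm (Fin (n + 1))} {c : Fin (n + 1)}
    {l₀ : List (Perm (Fin (n + 1)))} (h : IsPushPath x y l₀) (hu : Follows u (u * shift n) l₀)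
    {i₀ : ℕ} (hv : v = u * rot3 n (n - 3) * shift n ^ i₀)
    (ho : o = u * rot3 n (n - 3) * rot3 n (n - 3)) (hol : ∀ i, o * shift n ^ i ∉ l₀)
    {B : Finset (Perm (Fin (n + 1)))} (hB : Grows (RotEdge n) {v} B) :
    (∀ g ∈ B, g (pos n (n - 1)) = c) → (∀ g ∈ B, ∀ i, g * shift n ^ i ∉ l₀) →
    (∀ g ∈ B, ∀ i, o ≠ g * shift n ^ i) →
    ∃ l, IsPushPath x y l ∧ l.length = l₀.length + n + n * B.card ∧
      (∀ σ ∈ l, σ ∈ l₀ ∨ (∃ i, σ = o * shift n ^ i) ∨ ∃ g ∈ B, ∃ i, σ = g * shift n ^ i) ∧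
      (∀ g ∈ B, ∀ i, g * shift n ^ i * rot3 n (n - 3) ∉ l →
        Follows (g * shift n ^ i) (g * shift n ^ i * shift n) l) := by
  induction hB with
  | refl =>
    intro _ hl hdo
    simp only [Finset.mem_singleton, forall_eq] at hl hdo
    obtain ⟨j₀, hj₀⟩ := mul_shift_pow_mul_pow (n := n) (by lia) (u * rot3 n (n - 3)) i₀
    rw [← hv] at hj₀
    have key : ∀ i, ∃ j, u * rot3 n (n - 3) * shift n ^ i = v * shift n ^ j := fun i =>
      ⟨j₀ + i, by rw [pow_add, ← mul_assoc, hj₀]⟩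
    obtain ⟨l, p₁, p₂, p₃, -, p₅⟩ := exists_glued_path hn h hu
      (fun i => by obtain ⟨j, hj⟩ := key i; rw [hj]; exact hl j)
      (fun i => by rw [← ho]; exact hol i)
      (fun i => by obtain ⟨j, hj⟩ := key i; rw [hj, ← ho]; exact hdo j)
    refine ⟨l, p₁, by rw [p₂, Finset.card_singleton]; lia, fun σ hσ => ?_, ?_⟩
    · rcases (p₃ σ).1 hσ with hσ | ⟨i, hσ⟩ | ⟨i, hσ⟩
      · exact Or.inl hσ
      · obtain ⟨j, hj⟩ := key i
        exact Or.inr (Or.inr ⟨v, Finset.mem_singleton_self _, j, hσ.trans hj⟩)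
      · exact Or.inr (Or.inl ⟨i, by rw [ho]; exact hσ⟩)
    · intro g hg i hi
      rw [Finset.mem_singleton.1 hg] at hi ⊢
      rw [hv, mul_assoc _ (shift n ^ i₀), ← pow_add] at hi ⊢
      refine p₅ _ (Or.inl rfl) _ fun e => hi ?_
      rw [e, p₃]
      exact Or.inr (Or.inr ⟨0, by rw [pow_zero, mul_one]⟩)
  | @tail B C _ hs ih =>
    intro hc hl hdo
    obtain ⟨a, b, d, ⟨j, hj, hb', hd'⟩, ha, hb, hd, hbd, rfl⟩ := hs
    rw [← hb'] at hd'
    have hsub : ∀ g ∈ B, g ∈ insert b (insert d B) := fun g hg => by simp [hg]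
    have hbC : b ∈ insert b (insert d B) := by simp
    have hdC : d ∈ insert b (insert d B) := by simp
    obtain ⟨l, p₁, p₂, p₃, p₄⟩ := ih (fun g hg => hc g (hsub g hg)) (fun g hg => hl g (hsub g hg))
      (fun g hg => hdo g (hsub g hg))
    -- All representatives have the entry `c` at index `n - 1`, and only the trivial shift fixes
    -- that index, so distinct representatives have disjoint cycles.
    have ring_eq : ∀ g ∈ insert b (insert d B), ∀ g' ∈ insert b (insert d B), ∀ i i',
        g * shift n ^ i = g' * shift n ^ i' → g = g' := by
      intro g hg g' hg' i i' e
      obtain ⟨k, hk⟩ := mul_shift_pow_mul_pow (n := n) (by lia) g i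
      rw [e, mul_assoc, ← pow_add] at hk
      have e₁ : (shift n ^ (i' + k)) (pos n (n - 1)) = pos n (n - 1) := by
        apply g'.injective
        rw [← Perm.mul_apply, hk, hc g hg, hc g' hg']
      rw [← hk, shift_pow_eq_one (by lia) e₁, mul_one]
    have hnot : ∀ g ∈ insert b (insert d B), g ∉ B → ∀ i, g * shift n ^ i ∉ l := by
      intro g hg hgB i hi
      rcases p₃ _ hi with hi | ⟨k, hi⟩ | ⟨g', hg', k, hi⟩
      · exact hl g hg i hi
      · obtain ⟨k', hk'⟩ := mul_shift_pow_mul_pow (n := n) (by lia) o k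
        rw [← hi, mul_assoc, ← pow_add] at hk'
        exact hdo g hg _ hk'.symm
      · exact hgB (ring_eq g hg g' (hsub g' hg') _ _ hi ▸ hg')
    -- This is the member of the cycle of `a` at which the rotation at `j` becomes the rotation at
    -- `n - 3`. The shift step out of `w` is still present, since the cycle of `b` has not been
    -- visited.
    set w := a * shift n ^ (n - 3 - j) with hw
    have hQ : ∀ z, z * shift n ^ (n - 3 - j) * rot3 n (n - 3) =
        z * rot3 n j * shift n ^ (n - 3 - j) := fun z => by
      have := rot3_mul_shift_pow (n := n) (j := j) (c := n - 3 - j) (by lia)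
      rw [show j + (n - 3 - j) = n - 3 by lia] at this
      rw [mul_assoc, ← this, mul_assoc]
    have hwb : w * rot3 n (n - 3) = b * shift n ^ (n - 3 - j) := by rw [hw, hQ, ← hb']
    have hwd : w * rot3 n (n - 3) * rot3 n (n - 3) = d * shift n ^ (n - 3 - j) := by
      rw [hwb, hQ, ← hd']
    have hwl : Follows w (w * shift n) l := p₄ a ha _ (by rw [hwb]; exact hnot b hbC hb _)
    obtain ⟨l', q₁, q₂, q₃, q₄, q₅⟩ := exists_glued_path hn p₁ hwl
      (fun i => by rw [hwb, mul_assoc, ← pow_add]; exact hnot b hbC hb _)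
      (fun i => by rw [hwd, mul_assoc, ← pow_add]; exact hnot d hdC hd _)
      (fun i e => by
        rw [hwd, hwb, mul_assoc b, ← pow_add] at e
        exact hbd (ring_eq d hdC b hbC _ _ e).symm)
    have hw₀ : w * rot3 n (n - 3) ∈ l' :=
      (q₃ _).2 (Or.inr (Or.inl ⟨0, by rw [pow_zero, mul_one]⟩))
    have hw₁ : w * rot3 n (n - 3) * rot3 n (n - 3) ∈ l' :=
      (q₃ _).2 (Or.inr (Or.inr ⟨0, by rw [pow_zero, mul_one]⟩))
    have hw₂ : w * rot3 n (n - 3) * rot3 n (n - 3) * rot3 n (n - 3) ∈ l' := by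
      have := rot3_mul_rot3_mul_rot3 (n := n) (j := n - 3) (by lia)
      rw [mul_assoc, mul_assoc, ← mul_assoc (rot3 n (n - 3)), this, mul_one]
      obtain ⟨m₁, m₂, hm⟩ := hwl
      exact (q₃ _).2 (Or.inl (by rw [hm]; simp))
    refine ⟨l', q₁, ?_, fun σ hσ => ?_, ?_⟩
    · rw [q₂, p₂, Finset.card_insert_of_notMem (by simp [hb, hbd]),
        Finset.card_insert_of_notMem hd]
      ring
    · rcases (q₃ σ).1 hσ with hσ | ⟨i, hσ⟩ | ⟨i, hσ⟩
      · rcases p₃ σ hσ with hσ | hσ | ⟨g, hg, hσ⟩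
        · exact Or.inl hσ
        · exact Or.inr (Or.inl hσ)
        · exact Or.inr (Or.inr ⟨g, hsub g hg, hσ⟩)
      · rw [hwb, mul_assoc, ← pow_add] at hσ
        exact Or.inr (Or.inr ⟨b, hbC, _, hσ⟩)
      · rw [hwd, mul_assoc, ← pow_add] at hσ
        exact Or.inr (Or.inr ⟨d, hdC, _, hσ⟩)
    -- On an inserted cycle only the end `z` need not be followed by its shift. The rotation of `z`
    -- is already in the list, so the invariant claims nothing there.
    · have hring : ∀ g z, z = w * rot3 n (n - 3) ∨ z = w * rot3 n (n - 3) * rot3 n (n - 3) →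
          z = g * shift n ^ (n - 3 - j) → z * rot3 n (n - 3) ∈ l' →
          ∀ i, g * shift n ^ i * rot3 n (n - 3) ∉ l' →
          Follows (g * shift n ^ i) (g * shift n ^ i * shift n) l' := by
        intro g z hz hgz hzl i hi
        obtain ⟨k, hk⟩ := mul_shift_pow_mul_pow (n := n) (by lia) g (n - 3 - j)
        rw [← hgz] at hk
        have e : g * shift n ^ i = z * shift n ^ (k + i) := by rw [pow_add, ← mul_assoc, hk]
        rw [e] at hi ⊢
        exact q₅ z hz _ fun e' => hi (by rw [e']; exact hzl)
      intro g hg i hi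
      simp only [Finset.mem_insert] at hg
      rcases hg with rfl | rfl | hg
      · exact hring _ _ (Or.inl rfl) hwb hw₁ i hi
      · exact hring _ _ (Or.inr rfl) hwd hw₂ i hi
      · exact q₄ _ (fun e => hi (by rw [e]; exact hw₀))
          (p₄ g hg i fun hm => hi ((q₃ _).2 (Or.inl hm)))

end Gluing

/-! ### Long paths in a class -/

section ClassPath

variable {n : ℕ}

theorem eq_of_mul_shift_pow_eq (hn : 1 ≤ n) {g g' : Perm (Fin (n + 1))} {i j : ℕ}
    (hg : g (pos n (n - 1)) = g' (pos n (n - 1))) (h : g * shift n ^ i = g' * shift n ^ j) :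
    g = g' := by
  obtain ⟨k, hk⟩ := mul_shift_pow_mul_pow (n := n) hn g i
  rw [h, mul_assoc, ← pow_add] at hk
  have e₁ : (shift n ^ (j + k)) (pos n (n - 1)) = pos n (n - 1) := by
    apply g'.injective
    rw [← Perm.mul_apply, hk, hg]
  rw [← hk, shift_pow_eq_one hn e₁, mul_one]

theorem sign_shift (hn : Odd n) : Perm.sign (shift n) = 1 := by
  rw [shift, sign_top (by lia)]
  obtain ⟨r, rfl⟩ := hn
  exact Even.neg_one_pow ⟨r, by lia⟩

theorem shift_pow_pos (hn : 1 ≤ n) {j i : ℕ} (hj : j < n) (hi : i ≤ j) :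
    (shift n ^ i) (pos n j) = pos n (j - i) := by
  apply Fin.ext
  rw [shift_pow_val hn _ _ (by lia), pos_val (by lia), pos_val (by lia)]
  split_ifs <;> lia

theorem shift_pow_pos_last (hn : 1 ≤ n) (i : ℕ) : (shift n ^ i) (pos n n) = pos n n := by
  apply Fin.ext
  rw [shift_pow_mod hn, shift_pow_val hn _ _ (Nat.mod_lt _ hn).le, pos_val le_rfl, if_pos rfl]

/-- A class of permutations with the same last entry and the same sign contains a long path from
`x` to its shift, which avoids the shift cycle of `f`. -/
theorem exists_class_path (hn : 7 ≤ n) (hodd : Odd n) (x f : Perm (Fin (n + 1)))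
    (hf₁ : ∀ i, f ≠ x * rot3 n (n - 3) * shift n ^ i)
    (hf₂ : ∀ i, f ≠ x * rot3 n (n - 3) * rot3 n (n - 3) * shift n ^ i) {ε : ℕ} (hε : ε ≤ 1) :
    ∃ l, IsPushPath x (x * shift n) l ∧
      2 * l.length + 4 * n * ε = 4 + n * ((n - 2) * (n - 2).factorial) ∧
      ∀ σ ∈ l, σ (pos n n) = x (pos n n) ∧ Perm.sign σ = Perm.sign x ∧
        ((∃ i, σ = f * shift n ^ i) → σ = x ∨ σ = x * shift n) := by
  obtain ⟨M, hn_def⟩ : ∃ M, n = M + 4 := ⟨n - 4, by lia⟩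
  have hM : Odd M := by
    obtain ⟨r, hr⟩ := hodd
    exact ⟨r - 2, by lia⟩
  have e₃ : n - 3 = M + 1 := by lia
  rw [e₃] at hf₁ hf₂
  set Q := rot3 n (M + 1) with hQ
  set T := shift n with hT
  have hT₁ : ∀ j, 0 < j → j < n → T (pos n j) = pos n (j - 1) := fun j h₀ hj => by
    have := shift_pow_pos (n := n) (by lia) hj (i := 1) (by lia)
    rwa [pow_one] at this
  have hQ₀ : Q (pos n (M + 1)) = pos n (M + 2) := rot3_apply_zero (by lia)
  have hQ₁ : Q (pos n (M + 2)) = pos n (M + 3) := rot3_apply_one (by lia)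
  have hQ₂ : Q (pos n (M + 3)) = pos n (M + 1) := rot3_apply_two
  have hQ' : ∀ j, j ≤ n → j ≤ M ∨ j = n → Q (pos n j) = pos n j := fun j hj h =>
    rot3_apply_pos_of_ne (by lia) hj (by lia) (by lia) (by lia)
  have sQ : Perm.sign Q = 1 := sign_rot3 (by lia)
  have sT : Perm.sign T = 1 := sign_shift hodd
  set g₀ := x * T with hg₀
  have g₀₁ : g₀ (pos n (n - 1)) = x (pos n (M + 2)) := by
    rw [hg₀, Perm.mul_apply, hT₁ _ (by lia) (by lia), show n - 1 - 1 = M + 2 by lia]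
  have g₀₂ : g₀ (pos n (M + 2)) = x (pos n (M + 1)) := by
    rw [hg₀, Perm.mul_apply, hT₁ _ (by lia) (by lia)]; rfl
  have g₀₃ : g₀ (pos n n) = x (pos n n) := by
    have := shift_pow_pos_last (n := n) (by lia) 1
    rw [pow_one] at this
    rw [hg₀, Perm.mul_apply, this]
  have sg₀ : Perm.sign g₀ = Perm.sign x := by rw [hg₀, Perm.sign_mul, sT, mul_one]
  have mem_C : ∀ σ, σ ∈ tailCoset n (M + 3) g₀ ↔ σ (pos n (n - 1)) = x (pos n (M + 2)) ∧
      σ (pos n n) = x (pos n n) ∧ Perm.sign σ = Perm.sign x := by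
    intro σ
    rw [mem_tailCoset, sg₀]
    constructor
    · rintro ⟨h₁, h₂⟩
      exact ⟨(h₁ (pos n (n - 1)) (by rw [pos_val (by lia)]; lia)).trans g₀₁,
        (h₁ _ (by rw [pos_val le_rfl]; lia)).trans g₀₃, h₂⟩
    · rintro ⟨h₁, h₂, h₃⟩
      refine ⟨fun p hp => ?_, h₃⟩
      have hp' := p.isLt
      have : p.val = n - 1 ∨ p.val = n := by lia
      rcases this with h | h <;> rw [← pos_val_self p, h]
      · rw [h₁, g₀₁]
      · rw [h₂, g₀₃]
  -- The representatives of the starting cycle and of the cycle of xQ² both have `z₀` at index `n -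
  -- 2`. Dropping that letter keeps the tree away from these two cycles, of which the first is used
  -- only at `x` and its shift.
  set z₀ := x (pos n (M + 1)) with hz₀
  set C := (tailCoset n (M + 3) g₀).filter fun σ => σ (pos n (M + 2)) ≠ z₀ with hC
  have hzL : z₀ ∈ headLetters n (M + 2) g₀ := by
    rw [← g₀₂, apply_mem_headLetters self_mem_tailCoset, pos_val (by lia)]
  -- Two shifts bring the required letter to index `n - 1`, so `v` represents the cycle of xQ.
  set v := x * Q * T ^ 2 with hv
  have hvC : v ∈ C := by
    refine Finset.mem_filter.2 ⟨(mem_C v).2 ⟨?_, ?_, ?_⟩, ?_⟩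
    · rw [hv, Perm.mul_apply, Perm.mul_apply, shift_pow_pos (by lia) (by lia) (by lia),
        show n - 1 - 2 = M + 1 by lia, hQ₀]
    · rw [hv, Perm.mul_apply, Perm.mul_apply, shift_pow_pos_last (by lia),
        hQ' _ (by lia) (by lia)]
    · rw [hv, Perm.sign_mul, Perm.sign_mul, map_pow, sQ, sT, one_pow, mul_one, mul_one]
    · rw [hv, Perm.mul_apply, Perm.mul_apply, shift_pow_pos (by lia) (by lia) (by lia),
        show M + 2 - 2 = M by lia, hQ' _ (by lia) (by lia)]
      exact x.injective.ne (pos_ne (by lia) (by lia) (by lia))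
  set o := x * Q * Q with ho
  have ho₁ : o (pos n (n - 1)) = x (pos n (M + 2)) := by
    rw [ho, Perm.mul_apply, Perm.mul_apply, show n - 1 = M + 3 by lia, hQ₂, hQ₀]
  have ho₂ : o (pos n (M + 2)) = z₀ := by
    rw [ho, Perm.mul_apply, Perm.mul_apply, hQ₁, hQ₂]
  have ho₃ : o (pos n n) = x (pos n n) := by
    rw [ho, Perm.mul_apply, Perm.mul_apply, hQ' _ (by lia) (by lia), hQ' _ (by lia) (by lia)]
  have so : Perm.sign o = Perm.sign x := by
    rw [ho, Perm.sign_mul, Perm.sign_mul, sQ, mul_one, mul_one]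
  have hog : o ≠ g₀ := by
    intro e
    have h₁ : o (pos n 0) = x (pos n 0) := by
      rw [ho, Perm.mul_apply, Perm.mul_apply, hQ' _ (by lia) (by lia), hQ' _ (by lia) (by lia)]
    have h₂ : g₀ (pos n 0) = x (pos n (n - 1)) := by
      rw [hg₀, Perm.mul_apply]
      congr 1
      apply Fin.ext
      rw [shift_val, pos_val (by lia), pos_val (by lia), if_pos rfl]
    rw [e, h₂] at h₁
    exact pos_ne (by lia) (by lia) (by lia) (x.injective h₁)
  have back : ∀ (w w' : Perm (Fin (n + 1))) (i j : ℕ), w * T ^ i = w' * T ^ j →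
      ∃ k, w = w' * T ^ k := by
    intro w w' i j e
    obtain ⟨k, hk⟩ := mul_shift_pow_mul_pow (n := n) (by lia) w i
    rw [e, mul_assoc, ← pow_add] at hk
    exact ⟨_, hk.symm⟩
  -- Some vertex has to be left out for parity. It is taken to represent the cycle of `f` when that
  -- cycle has a representative in `C`, and is otherwise an arbitrary vertex other than the root
  -- `v`.
  obtain ⟨h, hhC, hhv, hhf⟩ : ∃ h ∈ C, h ≠ v ∧ ∀ g ∈ C, ∀ i j, f * T ^ i = g * T ^ j → g = h := by
    by_cases H : ∃ g ∈ C, ∃ i, g = f * T ^ i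
    · obtain ⟨h, hhC, i, hi⟩ := H
      refine ⟨h, hhC, fun e => ?_, fun g hg k j hkj => ?_⟩
      · obtain ⟨k, hk⟩ := back f (x * Q) i 2 (by rw [← hi, e])
        exact hf₁ k hk
      · obtain ⟨r, hr⟩ := back f h 0 (n - i % n) (by
          have := Nat.mod_lt i (by lia : 0 < n)
          rw [hi, hT, shift_pow_mod (by lia) i, mul_assoc, ← pow_add,
            show i % n + (n - i % n) = n by lia, shift_pow_self (by lia), pow_zero])
        rw [hr, mul_assoc, ← pow_add] at hkj
        refine (eq_of_mul_shift_pow_eq (by lia) ?_ hkj).symm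
        rw [((mem_C _).1 (Finset.mem_filter.1 hhC).1).1, ((mem_C _).1 (Finset.mem_filter.1 hg).1).1]
    · refine ⟨v * rot3 n 0, ?_, ?_, fun g hg i j hij => ?_⟩
      · obtain ⟨h₁, h₂⟩ := Finset.mem_filter.1 hvC
        refine Finset.mem_filter.2 ⟨mul_rot3_mem_tailCoset h₁ (by lia) (by lia), ?_⟩
        rwa [Perm.mul_apply, rot3_apply_pos_of_ne (by lia) (by lia) (by lia) (by lia) (by lia)]
      · intro e
        have := congrArg (fun σ : Perm (Fin (n + 1)) => σ (pos n 0)) e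
        simp only [Perm.mul_apply, rot3_apply_zero (n := n) (j := 0) (by lia)] at this
        exact pos_ne (by lia) (by lia) (by lia) (v.injective this)
      · obtain ⟨k, hk⟩ := back g f j i hij.symm
        exact absurd ⟨g, hg, k, hk⟩ H
  have tree := isHypertree_erase_letter hM (by lia) (by lia) hzL hhC
  have hvS : v ∈ C.erase h := Finset.mem_erase.2 ⟨hhv.symm, hvC⟩
  have grow := tree v hvS
  have hcard := two_mul_card_erase_letter (n := n) (M := M) (by lia) hzL
  have hcard' := Finset.card_erase_add_one hhC
  rw [← hC] at hcard
  have hbig : 6 ≤ C.card := by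
    have h₁ : (M + 2).factorial ≥ M + 2 := Nat.self_le_factorial _
    nlinarith
  -- For `ε = 1` the last growth step is omitted, which saves two shift cycles, that is, 2n
  -- permutations.
  obtain ⟨B, hB, hBC, hBcard⟩ : ∃ B, Grows (RotEdge n) {v} B ∧ B ⊆ C.erase h ∧
      B.card + 2 * ε + 1 = C.card := by
    rcases Nat.le_one_iff_eq_zero_or_eq_one.1 hε with rfl | rfl
    · exact ⟨_, grow, Finset.Subset.refl _, by lia⟩
    · obtain ⟨B, h₁, h₂, h₃⟩ := grow.exists_last (by lia)
      exact ⟨B, h₁, h₂, by lia⟩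
  have hBC' : ∀ g ∈ B, g ≠ h ∧ g ∈ C := fun g hg => Finset.mem_erase.1 (hBC hg)
  have hl₀ : ∀ σ, σ ∈ [x, g₀] → ∃ j, σ = g₀ * T ^ j := by
    intro σ hσ
    simp only [List.mem_cons, List.not_mem_nil, or_false] at hσ
    rcases hσ with rfl | rfl
    · refine ⟨n - 1, ?_⟩
      rw [hg₀, mul_assoc, ← pow_succ', show n - 1 + 1 = n by lia, hT, shift_pow_self (by lia),
        mul_one]
    · exact ⟨0, by rw [pow_zero, mul_one]⟩
  have hC₁ : ∀ g ∈ B, g (pos n (n - 1)) = x (pos n (M + 2)) := fun g hg =>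
    ((mem_C _).1 (Finset.mem_filter.1 (hBC' g hg).2).1).1
  obtain ⟨l, p₁, p₂, p₃, -⟩ := exists_path_of_grows (n := n) (by lia) (x := x) (y := g₀) (u := x)
    (v := v) (o := o) (c := x (pos n (M + 2))) (l₀ := [x, g₀])
    { chain := List.isChain_pair.2 (pushStep_mul_top (by lia) (by lia) x)
      nodup := by
        simp only [List.nodup_cons, List.mem_cons, List.not_mem_nil, or_false, not_false_eq_true,
          List.nodup_nil, and_true]
        intro e
        have h₁ := g₀₂
        rw [← e] at h₁
        exact pos_ne (by lia) (by lia) (by lia) (x.injective h₁)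
      head := rfl
      last := rfl }
    ⟨[], [], rfl⟩ (i₀ := 2) (by rw [e₃]) (by rw [e₃])
    (fun i hi => by
      obtain ⟨j, hj⟩ := hl₀ _ hi
      exact hog (eq_of_mul_shift_pow_eq (by lia) (by rw [ho₁, g₀₁]) hj))
    hB hC₁
    (fun g hg i hi => by
      obtain ⟨j, hj⟩ := hl₀ _ hi
      have := eq_of_mul_shift_pow_eq (n := n) (by lia) (by rw [hC₁ g hg, g₀₁]) hj
      exact (Finset.mem_filter.1 (hBC' g hg).2).2 (by rw [this, g₀₂]))
    (fun g hg i hi => by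
      have := eq_of_mul_shift_pow_eq (n := n) (g := o) (g' := g) (i := 0) (j := i) (by lia)
        (by rw [hC₁ g hg, ho₁]) (by rw [pow_zero, mul_one, hi])
      exact (Finset.mem_filter.1 (hBC' g hg).2).2 (by rw [← this, ho₂]))
  have hpow : ∀ w i, (w * T ^ i) (pos n n) = w (pos n n) ∧ Perm.sign (w * T ^ i) = Perm.sign w := by
    intro w i
    rw [Perm.mul_apply, shift_pow_pos_last (by lia), Perm.sign_mul, map_pow, sT, one_pow, mul_one]
    exact ⟨rfl, rfl⟩
  refine ⟨l, p₁, ?_, fun σ hσ => ?_⟩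
  · rw [p₂, List.length_cons, List.length_singleton]
    have : n - 2 = M + 2 := by lia
    rw [this, ← hcard, ← hBcard]
    ring
  · rcases p₃ σ hσ with h₁ | ⟨i, h₁⟩ | ⟨g, hg, i, h₁⟩
    · simp only [List.mem_cons, List.not_mem_nil, or_false] at h₁
      refine ⟨?_, ?_, fun _ => h₁⟩
      · rcases h₁ with rfl | rfl
        · rfl
        · exact g₀₃
      · rcases h₁ with rfl | rfl
        · rfl
        · exact sg₀
    · refine ⟨?_, ?_, ?_⟩
      · rw [h₁, (hpow o i).1, ho₃]
      · rw [h₁, (hpow o i).2, so]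
      · rintro ⟨j, hj⟩
        obtain ⟨k, hk⟩ := back f o j i (by rw [← hj, h₁])
        exact absurd hk (hf₂ k)
    · obtain ⟨k₁, k₂, k₃⟩ := (mem_C g).1 (Finset.mem_filter.1 (hBC' g hg).2).1
      refine ⟨?_, ?_, ?_⟩
      · rw [h₁, (hpow g i).1, k₂]
      · rw [h₁, (hpow g i).2, k₃]
      · rintro ⟨j, hj⟩
        exact absurd (hhf g (hBC' g hg).2 j i (by rw [← hj, h₁])) (hBC' g hg).1

end ClassPath

/-! ### A short path of odd length -/

section SpecialPath

variable {n : ℕ}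

theorem top_pow_val {j : ℕ} (hj : j ≤ n) (p : Fin (n + 1)) (i : ℕ) (hi : i ≤ j + 1) :
    ((top n j ^ i) p).val =
      if j < p.val then p.val else if i ≤ p.val then p.val - i else p.val + (j + 1) - i := by
  induction i with
  | zero => simp only [pow_zero, Perm.one_apply]; split_ifs <;> lia
  | succ i ih =>
    rw [pow_succ', Perm.mul_apply, top_val hj, ih (by lia)]
    split_ifs <;> lia

theorem isPushPath_singleton (v : Perm (Fin (n + 1))) : IsPushPath v v [v] :=
  ⟨List.isChain_singleton v, List.nodup_singleton v, rfl, rfl⟩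

theorem isPushPath_map_top_pow {j m : ℕ} (h0 : 0 < j) (hj : j ≤ n) (hm : m ≤ j)
    (v : Perm (Fin (n + 1))) :
    IsPushPath v (v * top n j ^ m) ((List.range (m + 1)).map fun i => v * top n j ^ i) where
  chain := by
    rw [List.isChain_iff_getElem]
    intro i hi
    simp only [List.getElem_map, List.getElem_range]
    rw [pow_succ, ← mul_assoc]
    exact pushStep_mul_top h0 hj _
  nodup := by
    refine List.nodup_range.map_on fun a ha b hb h => ?_
    have h' := congrArg (fun σ : Perm (Fin (n + 1)) => (σ (pos n j)).val) (mul_left_cancel h)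
    rw [List.mem_range] at ha hb
    rw [top_pow_val hj _ _ (by lia), top_pow_val hj _ _ (by lia), pos_val hj] at h'
    split_ifs at h' <;> lia
  head := by rw [List.range_succ_eq_map, List.map_cons, pow_zero, mul_one]; rfl
  last := by rw [List.range_succ, List.map_append, List.map_singleton, List.getLast?_concat]

/-- A power of `top n j` would commute with `top n j`; evaluation at index 0 shows that the left
side does not. -/
theorem top_two_pow_ne_zpow_top {j a : ℕ} (hj : 3 ≤ j) (hjn : j ≤ n) (ha : a = 1 ∨ a = 2) (b : ℤ) :
    top n 2 ^ a ≠ top n j ^ b := by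
  intro h
  have hc : Commute (top n 2 ^ a) (top n j) := by rw [h]; exact (Commute.refl _).zpow_left b
  have h' := congrArg (fun σ : Perm (Fin (n + 1)) => (σ (pos n 0)).val) hc.eq
  simp only [Perm.mul_apply] at h'
  rw [top_pow_val (by lia) _ _ (by lia), top_val hjn, top_val hjn, top_pow_val (by lia) _ _ (by lia),
    pos_val (by lia)] at h'
  rcases ha with rfl | rfl <;> split_ifs at h' <;> lia

/-- With R = `top n (n - 5)`, which satisfies R^(n-4) = 1, a further R^(n-5) on the right turns the
product into the shift. This gives the word of the short path; for n = 7 it degenerates, as R is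
then `top n 2`. -/
theorem special_identity (hn : 9 ≤ n) :
    top n (n - 5) ^ 2 * top n 2 ^ 2 * top n (n - 5) ^ (n - 5) * shift n * top n 2 =
      shift n * top n (n - 5) := by
  ext p
  have h₁ := top_val (show 2 ≤ n by lia) p
  have h₂ := shift_val (top n 2 p)
  have h₃ := top_pow_val (show n - 5 ≤ n by lia) (shift n (top n 2 p)) (n - 5) (by lia)
  have h₄ := top_pow_val (show 2 ≤ n by lia) ((top n (n - 5) ^ (n - 5)) (shift n (top n 2 p))) 2
    (by lia)
  have h₅ := top_pow_val (show n - 5 ≤ n by lia)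
    ((top n 2 ^ 2) ((top n (n - 5) ^ (n - 5)) (shift n (top n 2 p)))) 2 (by lia)
  have h₆ := top_val (show n - 5 ≤ n by lia) p
  have h₇ := shift_val (top n (n - 5) p)
  simp only [Perm.mul_apply]
  generalize shift n (top n (n - 5) p) = q₇ at *
  generalize top n (n - 5) p = q₆ at *
  generalize (top n (n - 5) ^ 2) ((top n 2 ^ 2) _) = q₅ at *
  generalize (top n 2 ^ 2) _ = q₄ at *
  generalize (top n (n - 5) ^ (n - 5)) _ = q₃ at *
  generalize shift n _ = q₂ at *
  generalize top n 2 p = q₁ at *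
  have hp := p.isLt
  split_ifs at h₁ <;> split_ifs at h₂ <;> lia

theorem top_two_pow_three (hn : 2 ≤ n) : top n 2 ^ 3 = 1 := by
  ext p
  rw [top_pow_val hn _ _ le_rfl, Perm.one_apply]
  split_ifs <;> lia

theorem top_pow_pos_of_lt {j q : ℕ} (hj : j < q) (hq : q ≤ n) (i : ℕ) :
    (top n j ^ i) (pos n q) = pos n q := by
  induction i with
  | zero => rfl
  | succ i ih =>
    rw [pow_succ', Perm.mul_apply, ih]
    apply Fin.ext
    rw [top_val (by lia), pos_val hq, if_neg (by lia), if_neg (by lia)]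

/-- The class of `x` also contains a short path from `x` to its shift. -/
theorem exists_special_path_of_nine_le (hn : 9 ≤ n) (hodd : Odd n) (x : Perm (Fin (n + 1))) :
    ∃ l, IsPushPath x (x * shift n) l ∧ l.length + 3 = 2 * n ∧
      ∀ σ ∈ l, σ (pos n n) = x (pos n n) ∧ Perm.sign σ = Perm.sign x := by
  set R := top n (n - 5) with hR
  set U := top n 2 with hU
  set S := shift n with hS
  have hUne : ∀ a, a = 1 ∨ a = 2 → ∀ b : ℤ, U ^ a ≠ R ^ b := fun a ha b =>
    top_two_pow_ne_zpow_top (by lia) (by lia) ha b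
  have hU3 : U ^ 2 * U = 1 := by rw [← pow_succ]; exact top_two_pow_three (by lia)
  have hid : R ^ 2 * U ^ 2 * R ^ (n - 5) * S * U = S * R := special_identity hn
  have hR1 : R ^ (n - 4) = 1 := by
    ext p
    rw [top_pow_val (by lia) _ _ (by lia), Perm.one_apply]
    split_ifs <;> lia
  have sR : Perm.sign R = 1 := by
    rw [hR, sign_top (by lia)]
    obtain ⟨r, hr⟩ := hodd
    exact Even.neg_one_pow ⟨r - 2, by lia⟩
  have sU : Perm.sign U = 1 := by rw [hU, sign_top (by lia)]; rfl
  have sS : Perm.sign S = 1 := sign_shift hodd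
  have eR : ∀ q, n - 5 < q → q ≤ n → ∀ i, (R ^ i) (pos n q) = pos n q := fun q h₁ h₂ i =>
    top_pow_pos_of_lt h₁ h₂ i
  have eU : ∀ q, n - 5 < q → q ≤ n → ∀ i, (U ^ i) (pos n q) = pos n q := fun q h₁ h₂ i =>
    top_pow_pos_of_lt (by lia) h₂ i
  have eS : S (pos n (n - 1)) = pos n (n - 2) := by
    have := shift_pow_pos (n := n) (j := n - 1) (i := 1) (by lia) (by lia) (by lia)
    rwa [pow_one] at this
  have eS' : S (pos n n) = pos n n := by
    have := shift_pow_pos_last (n := n) (by lia) 1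
    rwa [pow_one] at this
  set d := x * (R ^ 2 * U ^ 2 * R ^ (n - 5) * S) with hd
  have hd' : d = x * S * R * U ^ 2 := by
    have : x * S * R = d * U := by rw [hd, mul_assoc x S, ← hid]; group
    rw [this, mul_assoc, ← pow_succ', pow_succ, hU3, mul_one]
  have pA := isPushPath_map_top_pow (n := n) (j := n - 5) (m := 2) (by lia) (by lia) (by lia) x
  have pB := isPushPath_singleton (x * R ^ 2 * U)
  have pC := isPushPath_map_top_pow (n := n) (j := n - 5) (m := n - 5) (by lia) (by lia) le_rfl
    (x * R ^ 2 * U ^ 2)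
  have pD := isPushPath_singleton d
  have pE := isPushPath_map_top_pow (n := n) (j := n - 5) (m := n - 5) (by lia) (by lia) le_rfl
    (x * S * R)
  rw [← hR] at pA pC pE
  have hend : x * S * R * R ^ (n - 5) = x * S := by
    rw [mul_assoc _ R, ← pow_succ', show n - 5 + 1 = n - 4 by lia, hR1, mul_one]
  rw [hend] at pE
  have stepU : ∀ σ, PushStep σ (σ * U) := fun σ => pushStep_mul_top (by lia) (by lia) σ
  have stepS : ∀ σ, PushStep σ (σ * S) := fun σ => pushStep_mul_top (by lia) (by lia) σ
  have key : ∀ a, a = 1 ∨ a = 2 → ∀ v : Perm (Fin (n + 1)), ∀ i j : ℕ,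
      v * R ^ i ≠ v * U ^ a * R ^ j := by
    intro a ha v i j h
    apply hUne a ha (i - j)
    rw [mul_assoc] at h
    rw [zpow_sub, zpow_natCast, zpow_natCast, mul_left_cancel h, mul_inv_cancel_right]
  have key' : ∀ (v : Perm (Fin (n + 1))) (j : ℕ), v * U ≠ v * U ^ 2 * R ^ j := by
    intro v j h
    apply hUne 1 (Or.inl rfl) (-j)
    rw [mul_assoc] at h
    have := mul_left_cancel h
    rw [pow_two, mul_assoc] at this
    rw [zpow_neg, zpow_natCast, pow_one, eq_inv_iff_mul_eq_one]
    exact (mul_left_cancel (a := U) (by rw [mul_one]; exact this)).symm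
  -- As R^(n-4) = 1, the first piece lies in the R-orbit of xR², and `key` can compare it with the
  -- pieces that follow.
  have pow_add_two : ∀ i : ℕ, x * R ^ i = x * R ^ 2 * R ^ (i + (n - 6)) := fun i => by
    rw [mul_assoc, ← pow_add, show 2 + (i + (n - 6)) = i + (n - 4) by lia, pow_add, hR1, mul_one]
  have low : ∀ v : Perm (Fin (n + 1)), ∀ i, (v * R ^ i) (pos n (n - 1)) = v (pos n (n - 1)) :=
    fun v i => by rw [Perm.mul_apply, eR _ (by lia) (by lia)]
  have low' : ∀ v : Perm (Fin (n + 1)), ∀ i, (v * U ^ i) (pos n (n - 1)) = v (pos n (n - 1)) :=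
    fun v i => by rw [Perm.mul_apply, eU _ (by lia) (by lia)]
  have high : ∀ v : Perm (Fin (n + 1)), (v * S) (pos n (n - 1)) = v (pos n (n - 2)) := fun v => by
    rw [Perm.mul_apply, eS]
  -- The pieces before and after the single use of S differ in their entry at index `n - 1`. Pieces
  -- on the same side are separated by `key` and `key'`.
  have hne : x (pos n (n - 1)) ≠ x (pos n (n - 2)) :=
    x.injective.ne (pos_ne (by lia) (by lia) (by lia))
  have valB : (x * R ^ 2 * U) (pos n (n - 1)) = x (pos n (n - 1)) := by
    have := low' (x * R ^ 2) 1
    rwa [pow_one, low] at this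
  have valC : ∀ i, (x * R ^ 2 * U ^ 2 * R ^ i) (pos n (n - 1)) = x (pos n (n - 1)) := fun i => by
    rw [low, low', low]
  have valE : ∀ i, (x * S * R * R ^ i) (pos n (n - 1)) = x (pos n (n - 2)) := fun i => by
    rw [mul_assoc _ R, ← pow_succ', low, high]
  have valD : d (pos n (n - 1)) = x (pos n (n - 2)) := by
    have := low (x * S) 1
    rw [hd', low', ← high, ← this, pow_one]
  have pDE := pD.append pE (by
      rw [show x * S * R = d * U by rw [hd, mul_assoc x S, ← hid]; group]; exact stepU d) (by
    rw [List.singleton_disjoint, List.mem_map]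
    rintro ⟨i, -, hi⟩
    have := key 2 (Or.inr rfl) (x * S * R) i 0
    rw [pow_zero, mul_one, ← hd'] at this
    exact this hi)
  have pCE := pC.append pDE (by
      have := stepS (x * R ^ 2 * U ^ 2 * R ^ (n - 5))
      rwa [show x * R ^ 2 * U ^ 2 * R ^ (n - 5) * S = d by rw [hd]; group] at this) (by
    intro σ hσ hσ'
    obtain ⟨i, -, rfl⟩ := List.mem_map.1 hσ
    rw [List.singleton_append, List.mem_cons, List.mem_map] at hσ'
    rcases hσ' with h | ⟨j, -, h⟩
    · exact hne (by rw [← valC i, h, valD])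
    · exact hne (by rw [← valC i, ← h, valE]))
  have pBE := pB.append pCE (by
      have := stepU (x * R ^ 2 * U)
      rwa [mul_assoc _ U, ← pow_two] at this) (by
    rw [List.singleton_disjoint]
    intro h
    rw [List.mem_append, List.singleton_append, List.mem_cons, List.mem_map, List.mem_map] at h
    rcases h with ⟨i, -, h⟩ | h | ⟨j, -, h⟩
    · exact key' _ _ h.symm
    · exact hne (by rw [← valB, h, valD])
    · exact hne (by rw [← valB, ← h, valE]))
  have pAE := pA.append pBE (stepU _) (by
    intro σ hσ hσ'
    obtain ⟨i, -, rfl⟩ := List.mem_map.1 hσ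
    rw [List.singleton_append, List.mem_cons, List.mem_append, List.singleton_append,
      List.mem_cons, List.mem_map, List.mem_map] at hσ'
    rcases hσ' with h | ⟨j, -, h⟩ | h | ⟨j, -, h⟩
    · rw [pow_add_two i] at h
      have := key 1 (Or.inl rfl) (x * R ^ 2) (i + (n - 6)) 0
      rw [pow_zero, mul_one, pow_one] at this
      exact this h
    · rw [pow_add_two i] at h
      exact key 2 (Or.inr rfl) _ _ _ h.symm
    · exact hne (by rw [← low x i, h, valD])
    · exact hne (by rw [← low x i, ← h, valE]))
  refine ⟨_, pAE, ?_, fun σ hσ => ?_⟩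
  · simp only [List.length_append, List.length_map, List.length_range, List.length_singleton]
    lia
  · have H : ∀ v : Perm (Fin (n + 1)), v (pos n n) = x (pos n n) ∧ Perm.sign v = Perm.sign x →
        ((v * U) (pos n n) = x (pos n n) ∧ Perm.sign (v * U) = Perm.sign x) ∧
        ((v * S) (pos n n) = x (pos n n) ∧ Perm.sign (v * S) = Perm.sign x) ∧
        ∀ i, (v * R ^ i) (pos n n) = x (pos n n) ∧ Perm.sign (v * R ^ i) = Perm.sign x := by
      rintro v ⟨h₁, h₂⟩
      have := eU n (by lia) le_rfl 1
      rw [pow_one] at this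
      refine ⟨⟨?_, ?_⟩, ⟨?_, ?_⟩, fun i => ⟨?_, ?_⟩⟩
      · rw [Perm.mul_apply, this, h₁]
      · rw [Perm.sign_mul, sU, mul_one, h₂]
      · rw [Perm.mul_apply, eS', h₁]
      · rw [Perm.sign_mul, sS, mul_one, h₂]
      · rw [Perm.mul_apply, eR n (by lia) le_rfl, h₁]
      · rw [Perm.sign_mul, map_pow, sR, one_pow, mul_one, h₂]
    have hx := H x ⟨rfl, rfl⟩
    have hC := (H _ (H _ (H _ (hx.2.2 2)).1).1).2.2
    simp only [mul_assoc _ U U, ← pow_two] at hC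
    have hd₁ := (H _ (hC (n - 5))).2.1
    have hE := (H _ ((H _ hx.2.1).2.2 1)).2.2
    simp only [pow_one] at hE
    simp only [List.mem_append, List.mem_map, List.mem_singleton] at hσ
    rcases hσ with ⟨i, -, rfl⟩ | rfl | ⟨i, -, rfl⟩ | rfl | ⟨i, -, rfl⟩
    · exact hx.2.2 i
    · exact (H _ (hx.2.2 2)).1
    · exact hC i
    · rwa [show x * R ^ 2 * U ^ 2 * R ^ (n - 5) * S = d by rw [hd]; group] at hd₁
    · exact hE i

theorem PushStep.mul_left {σ τ : Perm (Fin (n + 1))} (h : PushStep σ τ) (x : Perm (Fin (n + 1))) :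
    PushStep (x * σ) (x * τ) := by
  obtain ⟨j, hj, rfl⟩ := h
  exact ⟨j, hj, (mul_assoc _ _ _).symm⟩

theorem isChain_scanl_top {js : List ℕ} (h : ∀ j ∈ js, 0 < j ∧ j ≤ n) (x : Perm (Fin (n + 1))) :
    (js.scanl (fun σ j => σ * top n j) x).IsChain PushStep := by
  induction js generalizing x with
  | nil => exact List.isChain_singleton x
  | cons j js ih =>
    rw [List.scanl_cons]
    have hj := h j List.mem_cons_self
    have ht := ih (fun i hi => h i (List.mem_cons_of_mem _ hi)) (x * top n j)
    have hs := pushStep_mul_top hj.1 hj.2 x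
    cases js with
    | nil => exact List.isChain_pair.2 hs
    | cons i js =>
      rw [List.scanl_cons] at ht ⊢
      exact List.isChain_cons_cons.2 ⟨hs, ht⟩

/-- The analogue for `n = 7` of the word of `exists_special_path_of_nine_le`. -/
def specialWord : List ℕ := [4, 6, 6, 2, 2, 6, 6, 6, 6, 4]

set_option maxRecDepth 10000 in
theorem specialWord_spec :
    (specialWord.scanl (fun σ j => σ * top 7 j) 1).Nodup ∧
      (specialWord.scanl (fun σ j => σ * top 7 j) 1).getLast? = some (shift 7) := by
  decide +kernel

theorem scanl_top_spec {js : List ℕ} (h : ∀ j ∈ js, j < n ∧ Even j) (x : Perm (Fin (n + 1))) :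
    ∀ σ ∈ js.scanl (fun σ j => σ * top n j) x,
      σ (pos n n) = x (pos n n) ∧ Perm.sign σ = Perm.sign x := by
  induction js generalizing x with
  | nil => simp
  | cons j js ih =>
    rw [List.scanl_cons]
    intro σ hσ
    rcases List.mem_cons.1 hσ with rfl | hσ
    · exact ⟨rfl, rfl⟩
    · have hj := h j List.mem_cons_self
      obtain ⟨h₁, h₂⟩ := ih (fun i hi => h i (List.mem_cons_of_mem _ hi)) _ σ hσ
      have := top_pow_pos_of_lt hj.1 le_rfl 1
      rw [pow_one] at this
      rw [h₁, h₂, Perm.mul_apply, this, Perm.sign_mul, sign_top hj.1.le, hj.2.neg_one_pow, mul_one]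
      exact ⟨rfl, rfl⟩

theorem exists_special_path (hn : 7 ≤ n) (hodd : Odd n) (x : Perm (Fin (n + 1))) :
    ∃ l, IsPushPath x (x * shift n) l ∧ l.length + 3 = 2 * n ∧
      ∀ σ ∈ l, σ (pos n n) = x (pos n n) ∧ Perm.sign σ = Perm.sign x := by
  rcases (show n = 7 ∨ 9 ≤ n by obtain ⟨r, rfl⟩ := hodd; lia) with rfl | hn
  · refine ⟨(specialWord.scanl (fun σ j => σ * top 7 j) 1).map (x * ·), ⟨?_, ?_, ?_, ?_⟩, ?_, ?_⟩
    · rw [List.isChain_map]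
      exact (isChain_scanl_top (by decide) 1).imp fun _ _ h => h.mul_left x
    · exact specialWord_spec.1.map (mul_right_injective x)
    · rw [specialWord, List.scanl_cons, List.map_cons, mul_one]; rfl
    · rw [List.getLast?_map, specialWord_spec.2]; rfl
    · rw [List.length_map, List.length_scanl]; rfl
    · intro σ hσ
      obtain ⟨τ, hτ, rfl⟩ := List.mem_map.1 hσ
      obtain ⟨h₁, h₂⟩ := scanl_top_spec (n := 7) (by decide) 1 τ hτ
      rw [Perm.mul_apply, h₁, Perm.sign_mul, h₂, map_one, mul_one, Perm.one_apply]
      exact ⟨rfl, rfl⟩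
  · exact exists_special_path_of_nine_le hn hodd x

end SpecialPath

/-! ### The classes visited by the code -/

section Classes

variable {n : ℕ}

theorem shift_mul_top_val (hn : 2 ≤ n) (p : Fin (n + 1)) :
    ((shift n * top n n) p).val =
      if p.val = 0 then n else if p.val = 1 then n - 1 else p.val - 2 := by
  rw [Perm.mul_apply, shift_val, top_val le_rfl]
  have := p.isLt
  split_ifs <;> lia

/-- The product is one cycle of length n + 1: it runs down the even indices, jumps from 0 to n, runs
down the odd ones and jumps from 1 to n - 1. Up to H = (n+1)/2 steps involve at most one jump. -/
theorem shift_mul_top_pow_val {H : ℕ} (hH : n + 1 = 2 * H) (hn : 2 ≤ n) (p : Fin (n + 1)) (i : ℕ)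
    (hi : i ≤ H) : (((shift n * top n n) ^ i) p).val =
      if 2 * i ≤ p.val then p.val - 2 * i
      else if p.val % 2 = 0 then p.val + n + 2 - 2 * i else p.val + n - 2 * i := by
  have := p.isLt
  induction i with
  | zero => rw [pow_zero, Perm.one_apply]; simp
  | succ i ih =>
    rw [pow_succ', Perm.mul_apply, shift_mul_top_val hn, ih (by lia)]
    split_ifs <;> lia

theorem shift_mul_top_pow_add_val {H : ℕ} (hH : n + 1 = 2 * H) (hn : 2 ≤ n) (p : Fin (n + 1))
    (r : ℕ) (hr : r ≤ H) : (((shift n * top n n) ^ (r + H)) p).val =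
      if p.val % 2 = 0 then (if 2 * r ≤ p.val + 1 then p.val + 1 - 2 * r else p.val + 1 + n - 2 * r)
      else if 2 * r + 1 ≤ p.val then p.val - 1 - 2 * r else p.val + 1 + n - 2 * r := by
  have := p.isLt
  rw [pow_add, Perm.mul_apply, shift_mul_top_pow_val hH hn _ r hr,
    shift_mul_top_pow_val hH hn p H le_rfl]
  split_ifs <;> lia

theorem shift_mul_top_pow_succ_self (hn : 2 ≤ n) (hodd : Odd n) :
    (shift n * top n n) ^ (n + 1) = 1 := by
  obtain ⟨h, hh⟩ := hodd
  have e : (shift n * top n n) ^ (n + 1) = (shift n * top n n) ^ ((h + 1) + (h + 1)) := by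
    congr 1; lia
  rw [e]
  ext p
  have := p.isLt
  rw [shift_mul_top_pow_add_val (by lia) hn p _ le_rfl,
    Perm.one_apply]
  split_ifs <;> lia

/-- The first element of the `i`-th class of the code. -/
def classStart (n i : ℕ) : Perm (Fin (n + 1)) := top n n * (shift n * top n n) ^ i

theorem classStart_zero : classStart n 0 = top n n := by rw [classStart, pow_zero, mul_one]

theorem classStart_succ (i : ℕ) : classStart n (i + 1) = classStart n i * shift n * top n n := by
  rw [classStart, pow_succ, classStart]
  group

theorem classStart_self_mul_shift (hn : 2 ≤ n) (hodd : Odd n) : classStart n n * shift n = 1 := by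
  have h := shift_mul_top_pow_succ_self hn hodd
  rw [pow_succ] at h
  rw [classStart, mul_assoc, mul_eq_one_comm, mul_assoc, h]

theorem sign_classStart (hodd : Odd n) (i : ℕ) : Perm.sign (classStart n i) = (-1) ^ (i + 1) := by
  rw [classStart, Perm.sign_mul, map_pow, Perm.sign_mul, sign_shift hodd, sign_top le_rfl, one_mul,
    hodd.neg_one_pow, pow_succ']

theorem classStart_val {H : ℕ} (hH : n + 1 = 2 * H) (hn : 2 ≤ n) (p : Fin (n + 1)) (i : ℕ)
    (hi : i ≤ H) : (classStart n i p).val =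
      if p.val = 2 * i then n
      else if 2 * i ≤ p.val then p.val - 2 * i - 1
      else if p.val % 2 = 0 then p.val + n + 1 - 2 * i
      else if p.val + n = 2 * i then n else p.val + n - 2 * i - 1 := by
  have := p.isLt
  rw [classStart, Perm.mul_apply, top_val le_rfl, shift_mul_top_pow_val hH hn p i hi]
  split_ifs <;> lia

theorem classStart_add_val {H : ℕ} (hH : n + 1 = 2 * H) (hn : 2 ≤ n) (p : Fin (n + 1))
    (r : ℕ) (hr : r < H) : (classStart n (r + H) p).val =
      if p.val % 2 = 0 then (if 2 * r ≤ p.val then p.val - 2 * r else p.val + n - 2 * r)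
      else if p.val = 2 * r + 1 then n
      else if 2 * r + 1 ≤ p.val then p.val - 2 - 2 * r else p.val + n - 2 * r := by
  have := p.isLt
  rw [classStart, Perm.mul_apply, top_val le_rfl, shift_mul_top_pow_add_val hH hn p r hr.le]
  split_ifs <;> lia

theorem classStart_last (hodd : Odd n) {i : ℕ} (hi : i < n) :
    (classStart n i (pos n n)).val = if 2 * i < n then n - 2 * i - 1 else 2 * n - 2 * i - 1 := by
  rcases (show n = 1 ∨ 2 ≤ n by lia) with rfl | hn
  · obtain rfl : i = 0 := by lia
    decide
  obtain ⟨h, hh⟩ := hodd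
  by_cases hih : i ≤ h
  · rw [classStart_val (H := h + 1) (by lia) hn _ _ (by lia), pos_val le_rfl]
    split_ifs <;> lia
  · obtain ⟨r, rfl⟩ : ∃ r, i = r + (h + 1) := ⟨i - (h + 1), by lia⟩
    rw [classStart_add_val (H := h + 1) (by lia) hn _ _ (by lia), pos_val le_rfl]
    split_ifs <;> lia

theorem classStart_last_lt (hodd : Odd n) {i : ℕ} (hi : i < n) :
    (classStart n i (pos n n)).val < n := by
  rw [classStart_last hodd hi]
  split_ifs <;> lia

/-- The last entry drops by 2 modulo `n` from one class to the next, and `n` is odd. -/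
theorem classStart_last_inj (hodd : Odd n) {i j : ℕ} (hi : i < n) (hj : j < n)
    (h : classStart n i (pos n n) = classStart n j (pos n n)) : i = j := by
  have h' := congrArg Fin.val h
  rw [classStart_last hodd hi, classStart_last hodd hj] at h'
  obtain ⟨m, rfl⟩ := hodd
  split_ifs at h' <;> lia

/-- A descent among the entries of `g` prevents `g` from being a shift of a transposition of other
letters. -/
theorem swap_ne_mul_shift_pow_of_descent (hn : 3 ≤ n) {g : Perm (Fin (n + 1))} {p c : ℕ}
    {b : Fin (n + 1)} (hp : p + 1 < n) (hc : c + 1 < n) (h₁ : g (pos n p) = pos n (c + 1))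
    (h₀ : g (pos n (p + 1)) = pos n c) (hb₁ : pos n (c + 1) ≠ b) (hb₀ : pos n c ≠ b) (j : ℕ) :
    swap b (pos n n) ≠ g * shift n ^ j := by
  intro h
  have hlt : (n - j % n) % n < n := Nat.mod_lt _ (by lia)
  have hg : swap b (pos n n) * shift n ^ ((n - j % n) % n) = g := by
    have := Nat.mod_lt j (show 0 < n by lia)
    rw [h, ← shift_pow_mod (by lia), shift_pow_mod (by lia) j, mul_assoc, ← pow_add,
      show j % n + (n - j % n) = n by lia, shift_pow_self (by lia), mul_one]
  set m := (n - j % n) % n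
  rw [← hg, Perm.mul_apply, ← swap_apply_of_ne_of_ne hb₁ (pos_ne (by lia) le_rfl (by lia))] at h₁
  rw [← hg, Perm.mul_apply, ← swap_apply_of_ne_of_ne hb₀ (pos_ne (by lia) le_rfl (by lia))] at h₀
  have e₁ := congrArg Fin.val ((swap b (pos n n)).injective h₁)
  have e₀ := congrArg Fin.val ((swap b (pos n n)).injective h₀)
  rw [shift_pow_val (by lia) _ _ hlt.le, pos_val (by lia), pos_val (by lia)] at e₁ e₀
  split_ifs at e₁ e₀ <;> lia

theorem eq_one_of_mul_shift_pow_eq (hn : 1 ≤ n) {g : Perm (Fin (n + 1))} {i j : ℕ}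
    (hg : g (pos n 0) = pos n 0) (h : g * shift n ^ i = shift n ^ j) : g = 1 := by
  obtain ⟨k, hk⟩ := mul_shift_pow_mul_pow (n := n) hn g i
  rw [h, ← pow_add, shift_pow_mod hn] at hk
  have hlt : (j + k) % n < n := Nat.mod_lt _ hn
  rw [← hk] at hg
  have h' := congrArg Fin.val hg
  rw [shift_pow_val hn _ _ hlt.le, pos_val (by lia)] at h'
  have : (j + k) % n = 0 := by split_ifs at h' <;> lia
  rw [← hk, this, pow_zero]

/-- In the classes 0 and n - 1 the transposition to be avoided lies on the shift cycle of the class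
start itself, at a shift which the path does not use. -/
theorem classStart_zero_mul (hn : 2 ≤ n) :
    swap (classStart n 0 (pos n n)) (pos n n) = classStart n 0 * shift n ^ (n - 1) := by
  have h : swap (classStart n 0 (pos n n)) (pos n n) * shift n = classStart n 0 := by
    have e : classStart n 0 (pos n n) = pos n (n - 1) := by
      apply Fin.ext
      rw [classStart_zero, top_val le_rfl, pos_val le_rfl, pos_val (by lia)]
      split_ifs <;> lia
    rw [e]
    ext p
    have := p.isLt
    rw [Perm.mul_apply, classStart_zero, top_val le_rfl, swap_apply_def]
    simp only [Fin.ext_iff, shift_val, pos_val le_rfl, pos_val (show n - 1 ≤ n by lia)]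
    split_ifs <;> (try simp only [shift_val, pos_val le_rfl, pos_val (show n - 1 ≤ n by lia)]) <;> lia
  conv_rhs => rw [← h, mul_assoc, ← pow_succ', show n - 1 + 1 = n by lia, shift_pow_self (by lia),
    mul_one]

theorem classStart_sub_one_mul (hn : 7 ≤ n) (hodd : Odd n) :
    swap (classStart n (n - 1) (pos n n)) (pos n n) = classStart n (n - 1) * shift n ^ 3 := by
  have e : classStart n (n - 1) (pos n n) = pos n 1 := by
    apply Fin.ext
    rw [classStart_last hodd (by lia), pos_val (by lia)]
    split_ifs <;> lia
  rw [e]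
  ext p
  obtain ⟨h, hh⟩ := hodd
  have e' : classStart n (n - 1) = classStart n ((h - 1) + (h + 1)) := by congr 1; lia
  rw [Perm.mul_apply, e', classStart_add_val (H := h + 1) (by lia) (by lia) _ _ (by lia),
    shift_pow_val (by lia) _ _ (by lia), swap_apply_def]
  have := p.isLt
  simp only [Fin.ext_iff, pos_val le_rfl, pos_val (show 1 ≤ n by lia)]
  split_ifs <;> (try simp only [pos_val le_rfl, pos_val (show 1 ≤ n by lia)]) <;> lia

/-- In the first and the last class the transposition is a known shift of the class start, hence not
on the cycle of a rotated start. In the others the start has neighbouring entries c + 1, c at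
indices which the rotation at `n - 3` fixes, whereas no shift of the transposition has such a
descent. -/
theorem swap_classStart_ne (hn : 7 ≤ n) (hodd : Odd n) {i : ℕ} (hi : i < n) (hev : Even i) :
    (∀ j, j ≤ 2 → swap (classStart n i (pos n n)) (pos n n) ≠ classStart n i * shift n ^ j) ∧
    (∀ j, swap (classStart n i (pos n n)) (pos n n) ≠
      classStart n i * rot3 n (n - 3) * shift n ^ j) ∧
    ∀ j, swap (classStart n i (pos n n)) (pos n n) ≠
      classStart n i * rot3 n (n - 3) * rot3 n (n - 3) * shift n ^ j := by
  by_cases hB : i = 0 ∨ i = n - 1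
  · obtain ⟨m, hm, hmn, e⟩ : ∃ m, 3 ≤ m ∧ m < n ∧
        swap (classStart n i (pos n n)) (pos n n) = classStart n i * shift n ^ m := by
      rcases hB with rfl | rfl
      · exact ⟨n - 1, by lia, by lia, classStart_zero_mul (by lia)⟩
      · exact ⟨3, by lia, by lia, classStart_sub_one_mul hn hodd⟩
    have q₀ : rot3 n (n - 3) (pos n 0) = pos n 0 :=
      rot3_apply_pos_of_ne (by lia) (by lia) (by lia) (by lia) (by lia)
    have q₁ : rot3 n (n - 3) (pos n (n - 3)) = pos n (n - 3 + 1) := rot3_apply_zero (by lia)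
    have q₂ : rot3 n (n - 3) (pos n (n - 3 + 1)) = pos n (n - 3 + 2) := rot3_apply_one (by lia)
    refine ⟨fun j hj h => ?_, fun j h => ?_, fun j h => ?_⟩
    · have := shift_pow_inj (by lia) hmn (by lia) (mul_left_cancel (e.symm.trans h))
      lia
    · have h' := e.symm.trans h
      rw [mul_assoc] at h'
      have := eq_one_of_mul_shift_pow_eq (by lia) q₀ (mul_left_cancel h').symm
      rw [this] at q₁
      exact pos_ne (by lia) (by lia) (by lia) q₁
    · have h' := e.symm.trans h
      rw [mul_assoc, mul_assoc, ← mul_assoc (rot3 _ _)] at h'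
      have := eq_one_of_mul_shift_pow_eq (by lia) (by rw [Perm.mul_apply, q₀, q₀])
        (mul_left_cancel h').symm
      have h₃ : (rot3 n (n - 3) * rot3 n (n - 3)) (pos n (n - 3)) = pos n (n - 3 + 2) := by
        rw [Perm.mul_apply, q₁, q₂]
      rw [this] at h₃
      exact pos_ne (by lia) (by lia) (by lia) h₃
  · obtain ⟨p, c, hp, hc, h₁, h₀⟩ : ∃ p c, p + 4 < n ∧ c + 1 < n ∧
        classStart n i (pos n p) = pos n (c + 1) ∧ classStart n i (pos n (p + 1)) = pos n c := by
      obtain ⟨h, hh⟩ := hodd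
      by_cases hih : i ≤ h
      · refine ⟨0, n - 2 * i, by lia, by lia, Fin.ext ?_, Fin.ext ?_⟩
        all_goals
          rw [classStart_val (H := h + 1) (by lia) (by lia) _ _ (by lia), pos_val (by lia),
            pos_val (by lia)]
          split_ifs <;> lia
      · obtain ⟨r, rfl⟩ : ∃ r, i = r + (h + 1) := ⟨i - (h + 1), by lia⟩
        refine ⟨2 * r + 2, 1, ?_, by lia, Fin.ext ?_, Fin.ext ?_⟩
        · obtain ⟨t, ht⟩ := hev
          lia
        all_goals
          obtain ⟨t, ht⟩ := hev
          rw [classStart_add_val (H := h + 1) (by lia) (by lia) _ _ (by lia), pos_val (by lia),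
            pos_val (by lia)]
          split_ifs <;> lia
    have hb₁ : pos n (c + 1) ≠ classStart n i (pos n n) := by
      rw [← h₁]
      exact (classStart n i).injective.ne (pos_ne (by lia) le_rfl (by lia))
    have hb₀ : pos n c ≠ classStart n i (pos n n) := by
      rw [← h₀]
      exact (classStart n i).injective.ne (pos_ne (by lia) le_rfl (by lia))
    have q₀ : rot3 n (n - 3) (pos n p) = pos n p :=
      rot3_apply_pos_of_ne (by lia) (by lia) (by lia) (by lia) (by lia)
    have q₁ : rot3 n (n - 3) (pos n (p + 1)) = pos n (p + 1) :=
      rot3_apply_pos_of_ne (by lia) (by lia) (by lia) (by lia) (by lia)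
    have key := fun (g : Perm (Fin (n + 1))) h₁ h₀ => swap_ne_mul_shift_pow_of_descent (g := g)
      (p := p) (c := c) (by lia) (by lia) hc h₁ h₀ hb₁ hb₀
    refine ⟨fun j _ => key _ h₁ h₀ j, key _ ?_ ?_, key _ ?_ ?_⟩
    · rw [Perm.mul_apply, q₀, h₁]
    · rw [Perm.mul_apply, q₁, h₀]
    · rw [Perm.mul_apply, Perm.mul_apply, q₀, q₀, h₁]
    · rw [Perm.mul_apply, Perm.mul_apply, q₁, q₁, h₀]

end Classes

/-! ### Joining the classes -/

section Assembly

variable {n : ℕ}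

theorem classStart_self (hn : 2 ≤ n) (hodd : Odd n) : classStart n n = shift n ^ (n - 1) := by
  refine mul_right_cancel (b := shift n) ?_
  rw [classStart_self_mul_shift hn hodd, ← pow_succ, show n - 1 + 1 = n by lia,
    shift_pow_self (by lia)]

/-- The permutations with the last entry and the sign of the `i`-th class which become neither the
first nor the last element of the code when their last letter is exchanged with `n`. -/
structure InClass (n i : ℕ) (σ : Perm (Fin (n + 1))) : Prop where
  last : σ (pos n n) = classStart n i (pos n n)
  sign : Perm.sign σ = (-1) ^ (i + 1)
  ne_one : swap (classStart n i (pos n n)) (pos n n) * σ ≠ 1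
  ne_self : swap (classStart n i (pos n n)) (pos n n) * σ ≠ classStart n n

theorem sign_swap_last {b : Fin (n + 1)} (hb : b ≠ pos n n) (σ : Perm (Fin (n + 1))) :
    Perm.sign (swap b (pos n n) * σ) = - Perm.sign σ := by
  rw [Perm.sign_mul, Perm.sign_swap hb, neg_one_mul]

theorem classStart_last_ne (hodd : Odd n) {i : ℕ} (hi : i < n) :
    classStart n i (pos n n) ≠ pos n n := by
  intro h
  have := classStart_last_lt hodd hi
  rw [h, pos_val le_rfl] at this
  exact lt_irrefl _ this

/-- Here the class is even, so an exchange of letters gives an odd permutation, while both ends of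
the code are even. No cycle has to be avoided, and any path in the class will do. -/
theorem inClass_of_odd (hn : 2 ≤ n) (hodd : Odd n) {i : ℕ} (hi : i < n) (hi' : Odd i)
    {σ : Perm (Fin (n + 1))} (h₁ : σ (pos n n) = classStart n i (pos n n))
    (h₂ : Perm.sign σ = Perm.sign (classStart n i)) : InClass n i σ := by
  have h₃ : Perm.sign σ = (-1) ^ (i + 1) := by rw [h₂, sign_classStart hodd]
  have h₄ : Perm.sign (swap (classStart n i (pos n n)) (pos n n) * σ) = -1 := by
    rw [sign_swap_last (classStart_last_ne hodd hi), h₃, (hi'.add_one).neg_one_pow]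
  refine ⟨h₁, h₃, fun h => ?_, fun h => ?_⟩
  · rw [h, map_one] at h₄
    exact absurd h₄ (by decide)
  · rw [h, classStart_self hn hodd, map_pow, sign_shift hodd, one_pow] at h₄
    exact absurd h₄ (by decide)

theorem exists_path_inClass (hn : 7 ≤ n) (hodd : Odd n) {i : ℕ} (hi : i < n)
    {ε : ℕ} (hε : ε ≤ 1) :
    ∃ l, IsPushPath (classStart n i) (classStart n i * shift n) l ∧
      2 * l.length + 4 * n * ε = 4 + n * ((n - 2) * (n - 2).factorial) ∧
      ∀ σ ∈ l, InClass n i σ := by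
  have hb := classStart_last_ne hodd hi
  have sQ : Perm.sign (rot3 n (n - 3)) = 1 := sign_rot3 (by lia)
  rcases Nat.even_or_odd i with hev | hod
  · obtain ⟨a₁, a₂, a₃⟩ := swap_classStart_ne hn hodd hi hev
    obtain ⟨l, hl, hlen, h⟩ := exists_class_path hn hodd (classStart n i)
      (swap (classStart n i (pos n n)) (pos n n)) a₂ a₃ hε
    refine ⟨l, hl, hlen, fun σ hσ => ?_⟩
    obtain ⟨h₁, h₂, h₃⟩ := h σ hσ
    set f := swap (classStart n i (pos n n)) (pos n n) with hf
    have hff : ∀ τ, f * σ = τ → σ = f * τ := fun τ h => by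
      rw [← h, ← mul_assoc, hf, swap_mul_self, one_mul]
    refine ⟨h₁, by rw [h₂, sign_classStart hodd], fun h => ?_, fun h => ?_⟩
    · have e := hff _ h
      rw [mul_one] at e
      -- `x` and `x * shift n` are the only members of the path which may lie on the cycle of `f`.
      -- Excluding both for the two ends of the code requires `f` to differ from the shifts of `x`
      -- by 0, 1 and 2.
      rcases h₃ ⟨0, by rw [e, pow_zero, mul_one]⟩ with h | h
      · exact a₁ 0 (by lia) (by rw [pow_zero, mul_one, ← e, h])
      · exact a₁ 1 (by lia) (by rw [pow_one, ← e, h])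
    · have e := hff _ h
      rw [classStart_self (by lia) hodd] at e
      have e' : f = σ * shift n := by
        rw [e, mul_assoc, ← pow_succ, show n - 1 + 1 = n by lia, shift_pow_self (by lia), mul_one]
      rcases h₃ ⟨_, e⟩ with h | h
      · exact a₁ 1 (by lia) (by rw [pow_one, e', h])
      · exact a₁ 2 (by lia) (by rw [pow_two, e', h, mul_assoc])
  · have hs : ∀ g j, Perm.sign g = 1 →
        swap (classStart n i (pos n n)) (pos n n) ≠ classStart n i * g * shift n ^ j := by
      intro g j hg h
      have h' := congrArg Perm.sign h
      rw [Perm.sign_swap hb, Perm.sign_mul, Perm.sign_mul, map_pow, sign_shift hodd, one_pow, hg,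
        sign_classStart hodd, (hod.add_one).neg_one_pow] at h'
      exact absurd h' (by decide)
    obtain ⟨l, hl, hlen, h⟩ := exists_class_path hn hodd (classStart n i)
      (swap (classStart n i (pos n n)) (pos n n)) (fun j => hs _ j sQ)
      (fun j => by
        rw [mul_assoc (classStart n i)]
        exact hs _ j (by rw [Perm.sign_mul, sQ, mul_one])) hε
    exact ⟨l, hl, hlen, fun σ hσ => inClass_of_odd (by lia) hodd hi hod (h σ hσ).1 (h σ hσ).2.1⟩

theorem IsPushPath.append_inClass {m : ℕ} (hodd : Odd n) (hm : m < n) (h1 : 1 ≤ m)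
    {l l' : List (Perm (Fin (n + 1)))}
    (h : IsPushPath (classStart n 0) (classStart n (m - 1) * shift n) l)
    (hl : ∀ σ ∈ l, ∃ i < m, InClass n i σ)
    (h' : IsPushPath (classStart n m) (classStart n m * shift n) l')
    (hl' : ∀ σ ∈ l', InClass n m σ) :
    IsPushPath (classStart n 0) (classStart n m * shift n) (l ++ l') ∧
      ∀ σ ∈ l ++ l', ∃ i < m + 1, InClass n i σ := by
  refine ⟨h.append h' ?_ ?_, fun σ hσ => ?_⟩
  · obtain ⟨r, rfl⟩ : ∃ r, m = r + 1 := ⟨m - 1, by lia⟩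
    rw [classStart_succ]
    exact pushStep_mul_top (by lia) le_rfl _
  · intro σ hσ hσ'
    obtain ⟨i, hi, h₁⟩ := hl σ hσ
    have := classStart_last_inj hodd (hi.trans hm) hm (h₁.last.symm.trans (hl' σ hσ').last)
    lia
  · rcases List.mem_append.1 hσ with hσ | hσ
    · obtain ⟨i, hi, h₁⟩ := hl σ hσ
      exact ⟨i, by lia, h₁⟩
    · exact ⟨m, by lia, hl' σ hσ⟩

/-- The short path, of length 2n - 3, goes into class 1, where no cycle must be avoided, and class 0
is shortened by 2n. Together they fall 3 short of one full long path, which is the 6 in the doubled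
count. -/
theorem exists_path_classes (hn : 7 ≤ n) (hodd : Odd n) {m : ℕ} (hm : 2 ≤ m) (hmn : m ≤ n) :
    ∃ l, IsPushPath (classStart n 0) (classStart n (m - 1) * shift n) l ∧
      2 * l.length + 6 = (m - 1) * (4 + n * ((n - 2) * (n - 2).factorial)) ∧
      ∀ σ ∈ l, ∃ i < m, InClass n i σ := by
  induction m, hm using Nat.le_induction with
  | base =>
    obtain ⟨l, hl, hlen, h⟩ := exists_path_inClass hn hodd (i := 0) (by lia) le_rfl
    obtain ⟨l', hl', hlen', h'⟩ := exists_special_path hn hodd (classStart n 1)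
    obtain ⟨h₁, h₂⟩ := IsPushPath.append_inClass hodd (m := 1) (by lia) le_rfl hl
      (fun σ hσ => ⟨0, by lia, h σ hσ⟩) hl'
      (fun σ hσ => inClass_of_odd (by lia) hodd (by lia) odd_one (h' σ hσ).1 (h' σ hσ).2)
    refine ⟨_, h₁, ?_, h₂⟩
    rw [List.length_append]
    lia
  | succ m hm ih =>
    obtain ⟨l, hl, hlen, h⟩ := ih (by lia)
    obtain ⟨l', hl', hlen', h'⟩ := exists_path_inClass hn hodd (i := m) (by lia)
      (Nat.zero_le 1)
    obtain ⟨h₁, h₂⟩ := IsPushPath.append_inClass hodd (by lia) (by lia) hl h hl' h'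
    refine ⟨_, h₁, ?_, h₂⟩
    obtain ⟨r, rfl⟩ : ∃ r, m = r + 1 := ⟨m - 1, by lia⟩
    rw [show r + 1 - 1 = r by lia] at hlen
    rw [List.length_append, show r + 1 + 1 - 1 = r + 1 by lia, add_one_mul, ← hlen, ← hlen']
    ring

theorem exists_aux_path (hn : 7 ≤ n) (hodd : Odd n) :
    ∃ l, IsPushPath 1 (classStart n n) (1 :: top n n :: l) ∧
      2 * (1 :: top n n :: l).length + 2 =
        (n - 1) * (4 + n * ((n - 2) * (n - 2).factorial)) ∧
      ∀ q ≠ pos n n, ∀ σ ∈ 1 :: top n n :: l, swap q (pos n n) * σ ∉ 1 :: top n n :: l := by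
  obtain ⟨l, hl, hlen, h⟩ := exists_path_classes hn hodd (m := n) (by lia) le_rfl
  have hlast : classStart n n (pos n n) = pos n n := by
    rw [classStart_self (by lia) hodd, shift_pow_pos_last (by lia)]
  have hne : ∀ σ ∈ l, σ (pos n n) ≠ pos n n := fun σ hσ => by
    obtain ⟨i, hi, h₁⟩ := h σ hσ
    rw [h₁.last]
    exact classStart_last_ne hodd hi
  have hmul : classStart n n = classStart n (n - 1) * shift n * top n n := by
    obtain ⟨r, rfl⟩ : ∃ r, n = r + 1 := ⟨n - 1, by lia⟩
    exact classStart_succ r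
  have hself : classStart n n ≠ 1 := by
    intro e
    have h₁ := classStart_self_mul_shift (n := n) (by lia) hodd
    rw [e, one_mul, ← pow_one (shift n), ← pow_zero (shift n)] at h₁
    have := shift_pow_inj (by lia) (by lia) (by lia) h₁
    lia
  have p₁ := hl.append (isPushPath_singleton (classStart n n))
    (by rw [hmul]; exact pushStep_mul_top (by lia) le_rfl _)
    (by
      rw [List.disjoint_singleton]
      exact fun hm => hne _ hm hlast)
  have p₂ := (isPushPath_singleton (1 : Perm (Fin (n + 1)))).append p₁
    (by
      rw [classStart_zero]
      have := pushStep_mul_top (n := n) (j := n) (by lia) le_rfl 1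
      rwa [one_mul] at this)
    (by
      rw [List.singleton_disjoint, List.mem_append, List.mem_singleton]
      rintro (hm | hm)
      · exact hne _ hm rfl
      · exact hself hm.symm)
  obtain ⟨t, rfl⟩ : ∃ t, l = top n n :: t := by
    have := hl.head
    rw [classStart_zero] at this
    exact ⟨l.tail, (List.cons_head?_tail this).symm⟩
  refine ⟨t ++ [classStart n n], p₂, ?_, ?_⟩
  · rw [← hlen]
    simp only [List.length_cons, List.length_append, List.length_nil]
    ring
  · have mem : ∀ σ, σ ∈ 1 :: top n n :: (t ++ [classStart n n]) ↔
        (σ = 1 ∨ σ = classStart n n) ∨ σ ∈ top n n :: t := fun σ => by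
      simp only [List.mem_cons, List.mem_append, List.not_mem_nil, or_false]
      tauto
    have ends : ∀ σ, σ = 1 ∨ σ = classStart n n → σ (pos n n) = pos n n := by
      rintro σ (rfl | rfl)
      · rfl
      · exact hlast
    have key : ∀ q, ∀ σ ∈ top n n :: t, ∀ τ, τ = swap q (pos n n) * σ →
        ¬ (τ = 1 ∨ τ = classStart n n) := by
      intro q σ hσ τ hτ hτ'
      have h₁ := ends τ hτ'
      have hq : q = σ (pos n n) := by
        rw [hτ, Perm.mul_apply] at h₁
        exact ((swap q (pos n n)).injective (h₁.trans (swap_apply_left q _).symm)).symm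
      obtain ⟨i, hi, h₂⟩ := h σ hσ
      rw [hq, h₂.last] at hτ
      rcases hτ' with h' | h'
      · exact h₂.ne_one (hτ.symm.trans h')
      · exact h₂.ne_self (hτ.symm.trans h')
    intro q hq σ hσ hτ
    have hs : ∀ τ : Perm (Fin (n + 1)), τ = swap q (pos n n) * (swap q (pos n n) * τ) := fun τ => by
      rw [← mul_assoc, swap_mul_self, one_mul]
    rcases (mem _).1 hσ with h₁ | h₁ <;> rcases (mem _).1 hτ with h₂ | h₂
    · have e := ends _ h₂
      rw [Perm.mul_apply, ends _ h₁, swap_apply_right] at e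
      exact hq e
    · exact key q _ h₂ _ (hs σ) h₁
    · exact key q _ h₁ _ rfl h₂
    · obtain ⟨i, hi, h₃⟩ := h _ h₁
      obtain ⟨j, hj, h₄⟩ := h _ h₂
      -- Either the exchange moves the letter `n` to the last place, which no class allows, or the
      -- last entry is unchanged, the class is the same, and the signs disagree.
      by_cases hσq : σ (pos n n) = q
      · apply classStart_last_ne hodd hj
        rw [← h₄.last, Perm.mul_apply, hσq, swap_apply_left]
      · have e := h₄.last
        rw [Perm.mul_apply, swap_apply_of_ne_of_ne hσq (hne _ h₁), h₃.last] at e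
        obtain rfl := classStart_last_inj hodd hi hj e
        have h₅ := h₄.sign
        rw [sign_swap_last hq, h₃.sign] at h₅
        rcases neg_one_pow_eq_or ℤˣ (i + 1) with h₆ | h₆ <;> rw [h₆] at h₅ <;>
          exact absurd h₅ (by decide)

end Assembly

/-! ### From paths to codes -/

section Packaging

variable {n : ℕ}

theorem isAuxCode_get {x y : Perm (Fin (n + 1))} {l : List (Perm (Fin (n + 1)))}
    (h : IsPushPath x y l) (hyx : PushStep y x)
    (ha : ∀ q ≠ pos n n, ∀ σ ∈ l, swap q (pos n n) * σ ∉ l) :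
    IsAuxCode (M := l.length) l.get where
  pushToTop :=
    { injective := List.nodup_iff_injective_get.1 h.nodup
      step := fun r hr => by
        obtain ⟨j, hj, e⟩ := List.isChain_iff_getElem.1 h.chain r hr
        exact ⟨_, ⟨j, hj, rfl⟩, e⟩
      cyclic := by
        have hne : l ≠ [] := by
          rintro rfl
          exact absurd h.head (by simp)
        have h0 : 0 < l.length := List.length_pos_of_ne_nil hne
        obtain ⟨j, hj, e⟩ := hyx
        refine ⟨h0, _, ⟨j, hj, rfl⟩, ?_⟩
        have h₁ := h.head
        have h₂ := h.last
        rw [List.head?_eq_getElem?, List.getElem?_eq_getElem h0] at h₁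
        rw [List.getLast?_eq_getElem?, List.getElem?_eq_getElem (by lia)] at h₂
        rw [List.get_eq_getElem, List.get_eq_getElem, Option.some.inj h₁, Option.some.inj h₂, e] }
  aux := by
    intro q hq σ hσ hτ
    have e : (⊤ : Fin (n + 1)) = pos n n := Fin.ext (by rw [pos_val le_rfl]; rfl)
    rw [e] at hq hτ
    obtain ⟨i, rfl⟩ := hσ
    obtain ⟨j, hj⟩ := hτ
    exact ha q hq.ne _ (List.get_mem l i) (hj ▸ List.get_mem l j)

theorem startsWith_get (l : List (Perm (Fin (n + 1)))) :
    StartsWith (M := (1 :: top n n :: l).length) (1 :: top n n :: l).get 1 (pushToTop ⊤) := by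
  refine ⟨by simp, rfl, ?_⟩
  have e : (⊤ : Fin (n + 1)) = pos n n := Fin.ext (by rw [pos_val le_rfl]; rfl)
  rw [pushToTop, e, pushToIndex, one_mul]
  rfl

/-- The construction for the symmetric group on an even number of at least eight letters. -/
theorem exists_auxCode (hn : 7 ≤ n) (hodd : Odd n) :
    ∃ M : ℕ, (∃ c : Fin M → Perm (Fin (n + 1)), IsAuxCode c ∧ StartsWith c 1 (pushToTop ⊤)) ∧
      2 * M + 2 = (n - 1) * (4 + n * ((n - 2) * (n - 2).factorial)) := by
  obtain ⟨l, hl, hlen, ha⟩ := exists_aux_path hn hodd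
  refine ⟨_, ⟨_, isAuxCode_get hl ?_ ha, startsWith_get l⟩, hlen⟩
  rw [← classStart_self_mul_shift (by lia) hodd]
  exact pushStep_mul_top (by lia) (by lia) _

theorem auxCode_size {n M : ℕ} (hn : 7 ≤ n)
    (hM : 2 * M + 2 = (n - 1) * (4 + n * ((n - 2) * (n - 2).factorial))) :
    (M : ℚ) = ((n : ℚ) - 2) * ((n.factorial : ℚ) / 2 + 2) + 1 := by
  obtain ⟨m, rfl⟩ : ∃ m, n = m + 2 := ⟨n - 2, by lia⟩
  rw [show m + 2 - 1 = m + 1 by lia, show m + 2 - 2 = m by lia] at hM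
  have h : (2 : ℚ) * M + 2 = (m + 1) * (4 + (m + 2) * (m * m.factorial)) := by exact_mod_cast hM
  rw [Nat.factorial_succ, Nat.factorial_succ]
  push_cast
  linarith

theorem lt_auxCode_size {k : ℕ} {M : ℚ} (hk : 6 < k)
    (hM : M = ((k : ℚ) - 3) * (((k - 1).factorial : ℚ) / 2 + 2) + 1) :
    M > ((k : ℚ) - 3) / k * ((k.factorial : ℚ) / 2) := by
  obtain ⟨n, rfl⟩ : ∃ n, k = n + 1 := ⟨k - 1, by lia⟩
  rw [hM, Nat.factorial_succ, show n + 1 - 1 = n by lia]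
  have h₁ : (6 : ℚ) < n + 1 := by exact_mod_cast hk
  push_cast
  rw [show ((n : ℚ) + 1 - 3) / (n + 1) * ((n + 1) * n.factorial / 2) =
    (n + 1 - 3) * (n.factorial / 2) by field_simp]
  linarith

end Packaging

/-! ### Six letters, by computation -/

section SixLetters

/-- The vector notation of a permutation. -/
def toVec {n : ℕ} (σ : Perm (Fin (n + 1))) : List ℕ := List.ofFn fun p => (σ p).val

theorem toVec_injective {n : ℕ} : Function.Injective (toVec (n := n)) := fun σ τ h => by
  ext p
  exact congrFun (List.ofFn_injective h) p

/-- The transition on the index `j`, in vector notation. -/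
def pushVec (j : ℕ) (a : List ℕ) : List ℕ := a.getD j 0 :: a.eraseIdx j

theorem toVec_mul_top {n j : ℕ} (hj : j ≤ n) (σ : Perm (Fin (n + 1))) :
    toVec (σ * top n j) = pushVec j (toVec σ) := by
  have hlen : (toVec σ).length = n + 1 := List.length_ofFn
  refine List.ext_getElem ?_ fun i h₁ h₂ => ?_
  · rw [pushVec, List.length_cons, List.length_eraseIdx_of_lt (by lia), hlen, toVec,
      List.length_ofFn]
    lia
  · have hi : i < n + 1 := by rwa [toVec, List.length_ofFn] at h₁
    have e : ∀ k (hk : k < n + 1), (top n j ⟨i, hi⟩).val = k →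
        (toVec (σ * top n j))[i] = (toVec σ)[k] := by
      intro k hk h
      simp only [toVec, List.getElem_ofFn, Perm.mul_apply]
      congr 2
      exact Fin.ext h
    have ht := top_val hj ⟨i, hi⟩
    simp only at ht
    rcases i with _ | i
    · rw [e j (by lia) (by rw [ht, if_pos rfl])]
      simp only [pushVec, List.getElem_cons_zero]
      rw [List.getD_eq_getElem _ _ (by lia)]
    · simp only [pushVec, List.getElem_cons_succ, List.getElem_eraseIdx]
      split_ifs with h
      · exact e i (by lia) (by rw [ht]; split_ifs <;> lia)
      · exact e (i + 1) (by lia) (by rw [ht]; split_ifs <;> lia)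

/-- The exchange of the letters `q` and `m`. -/
def swapLetter (q m z : ℕ) : ℕ := if z = q then m else if z = m then q else z

theorem toVec_swap_mul {n : ℕ} (q : Fin (n + 1)) (σ : Perm (Fin (n + 1))) :
    toVec (swap q (pos n n) * σ) = (toVec σ).map (swapLetter q.val n) := by
  rw [toVec, toVec, List.map_ofFn]
  congr 1
  ext p
  have e := pos_val (n := n) le_rfl
  simp only [Perm.mul_apply, Function.comp_apply, swapLetter, swap_apply_def, Fin.ext_iff, e]
  split_ifs <;> simp only [e]

/-- A number which stands for a vector. -/
def vecKey (a : List ℕ) : ℕ := a.foldl (fun c d => 6 * c + d) 0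

/-- Whether the vectors of a list are distinct and do not become each other when a letter is
exchanged with `m`; the bits of `s` stand for the vectors which precede the list. -/
def vecCheck (m : ℕ) : List (List ℕ) → ℕ → Bool
  | [], _ => true
  | a :: l, s =>
    !s.testBit (vecKey a) &&
      (List.range m).all (fun q => !s.testBit (vecKey (a.map (swapLetter q m)))) &&
      vecCheck m l (s ||| 2 ^ vecKey a)

/-- Injectivity of `vecKey` is not needed: equal vectors have equal keys, and a collision could only
make the check fail. -/
theorem vecCheck_spec {m : ℕ} {l : List (List ℕ)} {s : ℕ} (h : vecCheck m l s = true) :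
    (∀ a ∈ l, s.testBit (vecKey a) = false ∧
      ∀ q < m, s.testBit (vecKey (a.map (swapLetter q m))) = false) ∧
    l.Pairwise fun a b => a ≠ b ∧ ∀ q < m, b.map (swapLetter q m) ≠ a := by
  induction l generalizing s with
  | nil => simp
  | cons a l ih =>
    simp only [vecCheck, Bool.and_eq_true, Bool.not_eq_true', List.all_eq_true, List.mem_range] at h
    obtain ⟨⟨h₁, h₂⟩, h₃⟩ := h
    obtain ⟨i₁, i₂⟩ := ih h₃
    simp only [Nat.testBit_or, Bool.or_eq_false_iff] at i₁
    have self : (2 ^ vecKey a).testBit (vecKey a) = true := Nat.testBit_two_pow_self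
    refine ⟨fun b hb => ?_, List.pairwise_cons.2 ⟨fun b hb => ⟨?_, fun q hq => ?_⟩, i₂⟩⟩
    · rcases List.mem_cons.1 hb with rfl | hb
      · exact ⟨h₁, h₂⟩
      · exact ⟨(i₁ b hb).1.1, fun q hq => ((i₁ b hb).2 q hq).1⟩
    · rintro rfl
      rw [(i₁ _ hb).1.2] at self
      exact absurd self (by decide)
    · intro e
      have := ((i₁ _ hb).2 q hq).2
      rw [e, self] at this
      exact absurd this (by decide)

/-- The vectors obtained from `a` by successive transitions. -/
def pushVecs : List ℕ → List ℕ → List (List ℕ)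
  | [], a => [a]
  | j :: js, a => a :: pushVecs js (pushVec j a)

theorem map_toVec_scanl {n : ℕ} {js : List ℕ} (h : ∀ j ∈ js, j ≤ n) (σ : Perm (Fin (n + 1))) :
    (js.scanl (fun σ j => σ * top n j) σ).map toVec = pushVecs js (toVec σ) := by
  induction js generalizing σ with
  | nil => rfl
  | cons j js ih =>
    rw [List.scanl_cons, List.map_cons, ih (fun i hi => h i (List.mem_cons_of_mem _ hi)),
      toVec_mul_top (h j List.mem_cons_self), pushVecs]

theorem toVec_foldl {n : ℕ} {js : List ℕ} (h : ∀ j ∈ js, j ≤ n) (σ : Perm (Fin (n + 1))) :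
    toVec (js.foldl (fun σ j => σ * top n j) σ) = js.foldl (fun a j => pushVec j a) (toVec σ) := by
  induction js generalizing σ with
  | nil => rfl
  | cons j js ih =>
    rw [List.foldl_cons, List.foldl_cons, ih (fun i hi => h i (List.mem_cons_of_mem _ hi)),
      toVec_mul_top (h j List.mem_cons_self)]

/-- The indices of the successive transitions of the code in the symmetric group on six letters. -/
def sixWord : List ℕ :=
  [5, 2, 4, 2, 4, 2, 2, 4, 2, 2, 4, 4, 4, 2, 2, 4, 2, 2, 4, 2, 4, 4, 2, 2, 4, 4, 4, 4, 2, 2, 4,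
   4, 2, 2, 4, 4, 4, 2, 4, 4, 4, 2, 5, 2, 4, 2, 2, 4, 4, 2, 2, 4, 4, 2, 2, 4, 2, 2, 4, 2, 4, 4,
   2, 2, 4, 4, 4, 2, 4, 2, 2, 4, 2, 4, 2, 4, 2, 4, 4, 4, 2, 5, 2, 4, 4, 4, 4, 2, 2, 4, 4, 4, 2,
   4, 4, 4, 2, 4, 2, 2, 4, 4, 2, 2, 4, 4, 2, 4, 2, 2, 4, 2, 4, 2, 2, 4, 2, 2, 4, 4, 4, 2, 2, 4,
   2, 4, 4, 4, 2, 5, 4, 5, 2, 4, 2, 4, 4, 2, 2, 4, 4, 2, 4, 2, 4, 4, 4, 4, 2, 2, 4, 2, 4, 2, 4,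
   4, 4, 2, 2, 4, 4, 4, 4, 2, 2, 4, 4, 4, 2, 4, 2, 4, 2, 2, 4, 2, 5]

set_option maxRecDepth 100000 in
theorem vecCheck_sixWord : vecCheck 5 (pushVecs sixWord (toVec (1 : Perm (Fin 6)))) 0 = true := by
  decide +kernel

set_option maxRecDepth 100000 in
theorem foldl_sixWord : (sixWord ++ [4]).foldl (fun a j => pushVec j a)
    (toVec (1 : Perm (Fin 6))) = toVec (1 : Perm (Fin 6)) := by
  decide +kernel

set_option maxRecDepth 100000 in
/-- The construction for the symmetric group on six letters. -/
theorem exists_auxCode_six :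
    ∃ c : Fin 178 → Perm (Fin 6), IsAuxCode c ∧ StartsWith c 1 (pushToTop ⊤) := by
  obtain ⟨js, hjs⟩ : ∃ js, sixWord = 5 :: js := ⟨sixWord.tail, by decide +kernel⟩
  have hle : ∀ j ∈ sixWord, 0 < j ∧ j ≤ 5 := by decide +kernel
  set l := sixWord.scanl (fun σ j => σ * top 5 j) 1 with hl
  have hmap : l.map toVec = pushVecs sixWord (toVec 1) :=
    map_toVec_scanl (fun j hj => (hle j hj).2) 1
  have hpw := (vecCheck_spec vecCheck_sixWord).2
  rw [← hmap, List.pairwise_map] at hpw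
  have hl' : ∃ t, l = 1 :: top 5 5 :: t := by
    cases js with
    | nil => exact absurd (congrArg List.length hjs) (by decide)
    | cons j js =>
      rw [hl, hjs, List.scanl_cons, List.scanl_cons, one_mul]
      exact ⟨_, rfl⟩
  have hlen : l.length = 178 := by rw [hl, List.length_scanl]; decide +kernel
  obtain ⟨t, ht⟩ := hl'
  have path : IsPushPath 1 (sixWord.foldl (fun σ j => σ * top 5 j) 1) l :=
    { chain := isChain_scanl_top hle 1
      nodup := hpw.imp fun h e => h.1 (by rw [e])
      head := by rw [ht]; rfl
      last := List.getLast?_scanl }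
  have hback : PushStep (sixWord.foldl (fun σ j => σ * top 5 j) 1) 1 := by
    have e : (sixWord ++ [4]).foldl (fun σ j => σ * top 5 j) 1 = 1 := by
      apply toVec_injective
      rw [toVec_foldl, foldl_sixWord]
      intro j hj
      rcases List.mem_append.1 hj with hj | hj
      · exact (hle j hj).2
      · rw [List.mem_singleton.1 hj]; lia
    rw [List.foldl_append, List.foldl_cons, List.foldl_nil] at e
    conv_rhs => rw [← e]
    exact pushStep_mul_top (by lia) (by lia) _
  have haux : ∀ q ≠ pos 5 5, ∀ σ ∈ l, swap q (pos 5 5) * σ ∉ l := by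
    intro q hq σ hσ hτ
    have hq5 : q.val < 5 := by
      have := q.isLt
      have h5 : q.val ≠ 5 := fun h => hq (by rw [← pos_val_self q, h])
      lia
    have hne : σ ≠ swap q (pos 5 5) * σ := fun h =>
      hq (swap_eq_one_iff.1 (mul_eq_right.1 h.symm))
    have flip : ∀ τ, swap q (pos 5 5) * (swap q (pos 5 5) * τ) = τ := fun τ => by
      rw [← mul_assoc, swap_mul_self, one_mul]
    -- The check compares each vector only with earlier ones. As exchanging letters is an
    -- involution, this covers both orders.
    have h₁ : l.Pairwise fun σ τ => τ = swap q (pos 5 5) * σ → σ = τ :=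
      hpw.imp fun h e => absurd (by rw [← toVec_swap_mul, e, flip]) (h.2 _ hq5)
    have h₂ : l.Pairwise fun σ τ => σ = swap q (pos 5 5) * τ → τ = σ :=
      hpw.imp fun h e => absurd (by rw [← toVec_swap_mul, e]) (h.2 _ hq5)
    exact hne (List.Pairwise.forall_of_forall_of_flip (fun _ _ _ => rfl) h₁ h₂ hσ hτ rfl)
  have hc := isAuxCode_get path hback haux
  have hs := startsWith_get t
  rw [← ht] at hs
  -- Once the sequence and its length are variables, the length can be replaced by 178 without
  -- casts.
  generalize l.get = c at hc hs
  generalize l.length = M at *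
  subst hlen
  exact ⟨c, hc, hs⟩

end SixLetters

theorem mainTheorem3 (k : ℕ) [NeZero k] (hk : 6 ≤ k) (hk_even : Even k) :
    ∃ M : ℕ,
      (∃ c : Fin M → Equiv.Perm (Fin k), IsAuxCode c ∧ StartsWith c 1 (pushToTop ⊤)) ∧
      (M : ℚ) = (if k = 6 then 178 else
        ((k : ℚ) - 3) * (((k - 1).factorial : ℚ) / 2 + 2) + 1) ∧
      (6 < k → (M : ℚ) > ((k : ℚ) - 3) / k * ((k.factorial : ℚ) / 2)) := by
  rcases hk.eq_or_lt with rfl | hk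
  · obtain ⟨c, hc⟩ := exists_auxCode_six
    exact ⟨178, ⟨c, hc⟩, by norm_num, fun h => absurd h (lt_irrefl _)⟩
  · obtain ⟨n, rfl⟩ : ∃ n, k = n + 1 := ⟨k - 1, by lia⟩
    have hodd : Odd n := by
      obtain ⟨r, hr⟩ := hk_even
      exact ⟨r - 1, by lia⟩
    obtain ⟨r, hr⟩ := hodd
    have hn : 7 ≤ n := by lia
    obtain ⟨M, hc, hM⟩ := exists_auxCode hn ⟨r, hr⟩
    have hM' := auxCode_size hn hM
    have e : (M : ℚ) = (((n + 1 : ℕ) : ℚ) - 3) * (((n + 1 - 1).factorial : ℚ) / 2 + 2) + 1 := by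
      rw [hM', Nat.add_sub_cancel]
      push_cast
      ring
    exact ⟨M, hc, by rw [e, if_neg (by lia)], fun h => lt_auxCode_size h e⟩
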